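/- Consider two temporal description logics over the flow of time $(\mathbb{Z},<)$. Their vocabulary consists of object names $a_0,a_1,\dots$, concept names $A_0,A_1,\dots$, flexible role names $P_0,P_1,\dots$ and rigid role names $G_0,G_1,\dots$. Role names $S$, roles $R$ and concepts $C$ are given by $$S ::= P_i \mid G_i,\qquad R ::= S \mid S^- \mid \Diamond^{*} R \mid \Box^{*} R,\qquad C ::= \bot \mid A_i \mid\ \geq q\,R \mid \neg C \mid C_1\sqcap C_2 \mid D,$$ where $q\geq 1$ is an integer and $D$ is a temporal concept: * in $T^{*}_{X}\,\textit{DL-Lite}^{\mathcal N}_{bool}$: $D ::= \bigcirc_F C \mid \bigcirc_P C$ (next time and previous time); * in $T^{*}_{FP}\,\textit{DL-Lite}^{\mathcal N}_{bool}$: $D ::= \Box_F C \mid \Box_P C$ (always in the future and always in the past). A knowledge base (KB) consists of a finite set of concept inclusions $C_1\sqsubseteq C_2$ and a finite set of assertions of the forms $\bigcirc^n A_k(a_i)$, $\bigcirc^n\neg A_k(a_i)$, $\bigcirc^n S(a_i,a_j)$ and $\bigcirc^n\neg S(a_i,a_j)$ with $n\in\mathbb{Z}$. A temporal interpretation $\mathcal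 I$ has a non-empty domain $\Delta$ and interprets each object name by an element $a_i^{\mathcal I}\in\Delta$ (with $a_i^{\mathcal I}\neq a_j^{\mathcal I}$ for $i\neq j$), each concept name by sets $A_i^{\mathcal I(n)}\subseteq\Delta$, each flexible role name by relations $P_i^{\mathcal I(n)}\subseteq\Delta\times\Delta$ ($n\in\mathbb{Z}$), and each rigid role name by a relation $G_i^{\mathcal I}\subseteq\Delta\times\Delta$ that does not depend on time. $S^-$ is the inverse of $S$; $(\Diamond^{*}R)^{\mathcal I(n)}=\bigcup_{k\in\mathbb Z}R^{\mathcal I(k)}$ and $(\Box^{*}R)^{\mathcal I(n)}=\bigcap_{k\in\mathbb Z}R^{\mathcal I(k)}$; $(\geq q\,R)^{\mathcal I(n)}$ is the set of all $x$ with at least $q$ elements $y$ such that $(x,y)\in R^{\mathcal I(n)}$; $\bot$, $\neg$ and $\sqcap$ are the empty set, complement and intersection; $(\bigcirc_F C)^{\mathcal I(n)}=C^{\mathcal I(n+1)}$, $(\bigcirc_P C)^{\mathcal I(n)}=C^{\mathcal I(n-1)}$, $(\Box_F C)^{\mathcal I(n)}=\bigcap_{k>n}C^{\mathcal I(k)}$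 and $(\Box_P C)^{\mathcal I(n)}=\bigcap_{k<n}C^{\mathcal I(k)}$. $\mathcal I$ satisfies $C_1\sqsubseteq C_2$ if $C_1^{\mathcal I(n)}\subseteq C_2^{\mathcal I(n)}$ for all $n\in\mathbb Z$; it satisfies $\bigcirc^n A_k(a_i)$ if $a_i^{\mathcal I}\in A_k^{\mathcal I(n)}$, and $\bigcirc^n S(a_i,a_j)$ if $(a_i^{\mathcal I},a_j^{\mathcal I})\in S^{\mathcal I(n)}$; the negated assertions are satisfied if the respective membership fails. A KB is satisfiable if some temporal interpretation satisfies all of its members. **Theorem.** The problem of deciding whether a given $T^{*}_{X}\,\textit{DL-Lite}^{\mathcal N}_{bool}$ KB is satisfiable is undecidable, and so is the problem of deciding whether a given $T^{*}_{FP}\,\textit{DL-Lite}^{\mathcal N}_{bool}$ KB is satisfiable. -/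

import Mathlib

universe u

namespace TDL

/-! ### Syntax -/

/-- Role names: flexible `P_i` and rigid `G_i`. -/
inductive RoleName : Type
  | flexible (i : ℕ)
  | rigid (i : ℕ)

/-- Temporalised roles `R ::= S | S⁻ | ◇* R | □* R`, where `◇*` is "at some moment" and `□*` is
"at all moments". -/
inductive Role : Type
  | name (S : RoleName)
  | inv (S : RoleName)
  | sometime (R : Role)
  | always (R : Role)

/-- The two choices of temporal operators on concepts. -/
inductive Fragment : Type
  | X
  | FP

/-- The temporal operators on concepts: next and previous time in the fragment `X`,
always in the (strict) future and always in the (strict) past in the fragment `FP`. -/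
inductive TempOp : Fragment → Type
  | nextF : TempOp .X
  | nextP : TempOp .X
  | boxF : TempOp .FP
  | boxP : TempOp .FP

/-- Concepts: `⊥`, concept names `A_i`, number restrictions `≥ q R` (with `q` positive), closed
under `¬`, `⊓` and the temporal operators of the fragment. -/
inductive Concept (β : Fragment) : Type
  | bot : Concept β
  | atom (i : ℕ) : Concept β
  | atLeast (q : ℕ+) (R : Role) : Concept β
  | neg (C : Concept β) : Concept β
  | inter (C D : Concept β) : Concept β
  | temp (o : TempOp β) (C : Concept β) : Concept β

/-- ABox assertions `○ⁿ A_k(a_i)`, `○ⁿ ¬A_k(a_i)`, `○ⁿ S(a_i, a_j)`, `○ⁿ ¬S(a_i, a_j)` with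
`n ∈ ℤ`; object names are given by their indices. -/
inductive Assertion : Type
  | concept (n : ℤ) (k i : ℕ)
  | negConcept (n : ℤ) (k i : ℕ)
  | role (n : ℤ) (S : RoleName) (i j : ℕ)
  | negRole (n : ℤ) (S : RoleName) (i j : ℕ)

/-- Knowledge bases: a TBox, a pair `(C, D)` of which stands for the inclusion `C ⊑ D`, and an ABox.
The two finite sets are given as lists, as inputs of a decision procedure. -/
structure KB (β : Fragment) : Type where
  tbox : List (Concept β × Concept β)
  abox : List Assertion

/-! ### Semantics -/

/-- Temporal interpretations over `(ℤ, <)` with a constant domain, constant interpretation of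
object names and rigid role names, and the unique name assumption.  The domain is non-empty, as it
contains the interpretations of the object names. -/
structure Interp where
  Dom : Type u
  obj : ℕ → Dom
  una : Function.Injective obj
  conc : ℕ → ℤ → Set Dom
  flex : ℕ → ℤ → Dom → Dom → Prop
  rigid : ℕ → Dom → Dom → Prop

namespace Interp

/-- The extension of a role name at the moment `n`. -/
def roleName (I : Interp.{u}) : RoleName → ℤ → I.Dom → I.Dom → Prop
  | .flexible i, n => I.flex i n
  | .rigid i, _ => I.rigid i

/-- The extension of a role at the moment `n`. -/
def role (I : Interp.{u}) : Role → ℤ → I.Dom → I.Dom → Prop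
  | .name S, n => fun x y => I.roleName S n x y
  | .inv S, n => fun x y => I.roleName S n y x
  | .sometime R, _ => fun x y => ∃ k : ℤ, I.role R k x y
  | .always R, _ => fun x y => ∀ k : ℤ, I.role R k x y

end Interp

/-- The action of the temporal operators on time-dependent sets. -/
def TempOp.ext {Δ : Type u} : {β : Fragment} → TempOp β → (ℤ → Set Δ) → ℤ → Set Δ
  | _, .nextF, E, n => E (n + 1)
  | _, .nextP, E, n => E (n - 1)
  | _, .boxF, E, n => {x | ∀ k : ℤ, n < k → x ∈ E k}
  | _, .boxP, E, n => {x | ∀ k : ℤ, k < n → x ∈ E k}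

namespace Interp

/-- The extension of a concept at the moment `n`. -/
def concept (I : Interp.{u}) {β : Fragment} : Concept β → ℤ → Set I.Dom
  | .bot, _ => ∅
  | .atom i, n => I.conc i n
  | .atLeast q R, n => {x | ((q : ℕ) : ℕ∞) ≤ {y | I.role R n x y}.encard}
  | .neg C, n => (I.concept C n)ᶜ
  | .inter C D, n => I.concept C n ∩ I.concept D n
  | .temp o C, n => o.ext (fun k => I.concept C k) n

/-- Satisfaction of an ABox assertion (relative to the initial moment 0). -/
def SatAssertion (I : Interp.{u}) : Assertion → Prop
  | .concept n k i => I.obj i ∈ I.conc k n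
  | .negConcept n k i => I.obj i ∉ I.conc k n
  | .role n S i j => I.roleName S n (I.obj i) (I.obj j)
  | .negRole n S i j => ¬ I.roleName S n (I.obj i) (I.obj j)

/-- `I` is a model of the knowledge base `K`; concept inclusions are interpreted globally. -/
def IsModel (I : Interp.{u}) {β : Fragment} (K : KB β) : Prop :=
  (∀ c ∈ K.tbox, ∀ n : ℤ, I.concept c.1 n ⊆ I.concept c.2 n) ∧
    ∀ φ ∈ K.abox, I.SatAssertion φ

end Interp

/-- A knowledge base is satisfiable if it has a model. -/
def KB.Satisfiable {β : Fragment} (K : KB β) : Prop :=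
  ∃ I : Interp.{u}, I.IsModel K

/-! ### Effective coding of the syntax

The syntax is coded constructor by constructor, using the pairing function `Nat.pair`. -/

def RoleName.toNat : RoleName → ℕ
  | .flexible i => 2 * i
  | .rigid i => 2 * i + 1

def RoleName.ofNat (n : ℕ) : RoleName :=
  if n % 2 = 0 then .flexible (n / 2) else .rigid (n / 2)

theorem RoleName.ofNat_toNat (S : RoleName) : RoleName.ofNat S.toNat = S := by
  cases S with
  | flexible i => simp [RoleName.toNat, RoleName.ofNat]
  | rigid i =>
    have h : (2 * i + 1) / 2 = i := by omega
    simp [RoleName.toNat, RoleName.ofNat, h]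

theorem RoleName.toNat_ofNat (n : ℕ) : (RoleName.ofNat n).toNat = n := by
  unfold RoleName.ofNat
  split_ifs <;> simp only [RoleName.toNat] <;> omega

def RoleName.equivNat : RoleName ≃ ℕ :=
  ⟨RoleName.toNat, RoleName.ofNat, RoleName.ofNat_toNat, RoleName.toNat_ofNat⟩

instance : Primcodable RoleName := Primcodable.ofEquiv ℕ RoleName.equivNat

def Role.toNat : Role → ℕ
  | .name S => 4 * S.toNat
  | .inv S => 4 * S.toNat + 1
  | .sometime R => 4 * R.toNat + 2
  | .always R => 4 * R.toNat + 3

def Role.ofNat (n : ℕ) : Role :=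
  if n % 4 = 0 then .name (RoleName.ofNat (n / 4))
  else if n % 4 = 1 then .inv (RoleName.ofNat (n / 4))
  else if n % 4 = 2 then .sometime (Role.ofNat (n / 4))
  else .always (Role.ofNat (n / 4))
termination_by n
decreasing_by all_goals omega

theorem Role.ofNat_toNat (R : Role) : Role.ofNat R.toNat = R := by
  induction R with
  | name S =>
    rw [Role.ofNat, Role.toNat, if_pos (by omega), Nat.mul_div_cancel_left _ (by omega),
      RoleName.ofNat_toNat]
  | inv S =>
    have h : (4 * S.toNat + 1) / 4 = S.toNat := by omega
    rw [Role.ofNat, Role.toNat, if_neg (by omega), if_pos (by omega), h, RoleName.ofNat_toNat]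
  | sometime R ih =>
    have h : (4 * R.toNat + 2) / 4 = R.toNat := by omega
    rw [Role.ofNat, Role.toNat, if_neg (by omega), if_neg (by omega), if_pos (by omega), h, ih]
  | always R ih =>
    have h : (4 * R.toNat + 3) / 4 = R.toNat := by omega
    rw [Role.ofNat, Role.toNat, if_neg (by omega), if_neg (by omega), if_neg (by omega), h, ih]

theorem Role.toNat_ofNat (n : ℕ) : (Role.ofNat n).toNat = n := by
  induction n using Nat.strong_induction_on with
  | _ n ih =>
    rw [Role.ofNat]
    split_ifs with h0 h1 h2
    · rw [Role.toNat, RoleName.toNat_ofNat]; omega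
    · rw [Role.toNat, RoleName.toNat_ofNat]; omega
    · rw [Role.toNat, ih _ (by omega)]; omega
    · rw [Role.toNat, ih _ (by omega)]; omega

def Role.equivNat : Role ≃ ℕ := ⟨Role.toNat, Role.ofNat, Role.ofNat_toNat, Role.toNat_ofNat⟩

instance : Primcodable Role := Primcodable.ofEquiv ℕ Role.equivNat

def TempOp.toNat : {β : Fragment} → TempOp β → ℕ
  | _, .nextF => 0
  | _, .nextP => 1
  | _, .boxF => 0
  | _, .boxP => 1

def TempOp.ofNat : (β : Fragment) → ℕ → TempOp β
  | .X, n => if n = 0 then .nextF else .nextP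
  | .FP, n => if n = 0 then .boxF else .boxP

theorem TempOp.toNat_lt {β : Fragment} (o : TempOp β) : o.toNat < 2 := by
  cases o <;> decide

theorem TempOp.ofNat_toNat {β : Fragment} (o : TempOp β) : TempOp.ofNat β o.toNat = o := by
  cases o <;> rfl

theorem TempOp.toNat_ofNat (β : Fragment) (n : ℕ) (hn : n < 2) :
    (TempOp.ofNat β n).toNat = n := by
  cases β <;> interval_cases n <;> rfl

def Concept.toNat {β : Fragment} : Concept β → ℕ
  | .bot => 0
  | .atom i => 5 * i + 1
  | .atLeast q R => 5 * Nat.pair q.natPred R.toNat + 2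
  | .neg C => 5 * C.toNat + 3
  | .inter C D => 5 * Nat.pair C.toNat D.toNat + 4
  | .temp o C => 5 * (2 * C.toNat + o.toNat) + 5

def Concept.ofNat (β : Fragment) : ℕ → Concept β
  | 0 => .bot
  | n + 1 =>
    have h1 := Nat.unpair_left_le (n / 5)
    have h2 := Nat.unpair_right_le (n / 5)
    if n % 5 = 0 then .atom (n / 5)
    else if n % 5 = 1 then
      .atLeast (Nat.unpair (n / 5)).1.succPNat (Role.ofNat (Nat.unpair (n / 5)).2)
    else if n % 5 = 2 then .neg (Concept.ofNat β (n / 5))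
    else if n % 5 = 3 then
      .inter (Concept.ofNat β (Nat.unpair (n / 5)).1) (Concept.ofNat β (Nat.unpair (n / 5)).2)
    else .temp (TempOp.ofNat β (n / 5 % 2)) (Concept.ofNat β (n / 5 / 2))
termination_by n => n
decreasing_by all_goals omega

theorem Concept.ofNat_toNat {β : Fragment} (C : Concept β) : Concept.ofNat β C.toNat = C := by
  induction C with
  | bot => rw [Concept.toNat, Concept.ofNat]
  | atom i =>
    rw [Concept.toNat, Concept.ofNat, if_pos (by omega), Nat.mul_div_cancel_left _ (by omega)]
  | atLeast q R =>
    have h : (5 * Nat.pair q.natPred R.toNat + 1) / 5 = Nat.pair q.natPred R.toNat := by omega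
    rw [Concept.toNat, Concept.ofNat, if_neg (by omega), if_pos (by omega), h, Nat.unpair_pair,
      Role.ofNat_toNat, PNat.succPNat_natPred]
  | neg C ih =>
    have h : (5 * C.toNat + 2) / 5 = C.toNat := by omega
    rw [Concept.toNat, Concept.ofNat, if_neg (by omega), if_neg (by omega), if_pos (by omega), h,
      ih]
  | inter C D ihC ihD =>
    have h : (5 * Nat.pair C.toNat D.toNat + 3) / 5 = Nat.pair C.toNat D.toNat := by omega
    rw [Concept.toNat, Concept.ofNat, if_neg (by omega), if_neg (by omega), if_neg (by omega),
      if_pos (by omega), h, Nat.unpair_pair, ihC, ihD]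
  | temp o C ih =>
    have ho := o.toNat_lt
    have h : (5 * (2 * C.toNat + o.toNat) + 4) / 5 = 2 * C.toNat + o.toNat := by omega
    have h1 : (2 * C.toNat + o.toNat) % 2 = o.toNat := by omega
    have h2 : (2 * C.toNat + o.toNat) / 2 = C.toNat := by omega
    rw [Concept.toNat, Concept.ofNat, if_neg (by omega), if_neg (by omega), if_neg (by omega),
      if_neg (by omega), h, h1, h2, TempOp.ofNat_toNat, ih]

theorem Concept.toNat_ofNat (β : Fragment) (n : ℕ) : (Concept.ofNat β n).toNat = n := by
  induction n using Nat.strong_induction_on with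
  | _ n ih =>
    cases n with
    | zero => rw [Concept.ofNat, Concept.toNat]
    | succ n =>
      have h1 := Nat.unpair_left_le (n / 5)
      have h2 := Nat.unpair_right_le (n / 5)
      rw [Concept.ofNat]
      split_ifs with c0 c1 c2 c3
      · rw [Concept.toNat]; omega
      · rw [Concept.toNat, Role.toNat_ofNat, Nat.natPred_succPNat, Nat.pair_unpair]; omega
      · rw [Concept.toNat, ih _ (by omega)]; omega
      · rw [Concept.toNat, ih _ (by omega), ih _ (by omega), Nat.pair_unpair]; omega
      · rw [Concept.toNat, ih _ (by omega), TempOp.toNat_ofNat _ _ (by omega)]; omega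

def Concept.equivNat (β : Fragment) : Concept β ≃ ℕ :=
  ⟨Concept.toNat, Concept.ofNat β, Concept.ofNat_toNat, Concept.toNat_ofNat β⟩

instance (β : Fragment) : Primcodable (Concept β) := Primcodable.ofEquiv ℕ (Concept.equivNat β)

def Assertion.equivSum : Assertion ≃
    ((ℤ × ℕ × ℕ) ⊕ (ℤ × ℕ × ℕ)) ⊕ ((ℤ × RoleName × ℕ × ℕ) ⊕ (ℤ × RoleName × ℕ × ℕ)) where
  toFun
    | .concept n k i => .inl (.inl (n, k, i))
    | .negConcept n k i => .inl (.inr (n, k, i))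
    | .role n S i j => .inr (.inl (n, S, i, j))
    | .negRole n S i j => .inr (.inr (n, S, i, j))
  invFun
    | .inl (.inl (n, k, i)) => .concept n k i
    | .inl (.inr (n, k, i)) => .negConcept n k i
    | .inr (.inl (n, S, i, j)) => .role n S i j
    | .inr (.inr (n, S, i, j)) => .negRole n S i j
  left_inv φ := by cases φ <;> rfl
  right_inv s := by
    rcases s with (⟨_, _, _⟩ | ⟨_, _, _⟩) | (⟨_, _, _, _⟩ | ⟨_, _, _, _⟩) <;> rfl

instance : Primcodable Assertion := Primcodable.ofEquiv _ Assertion.equivSum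

def KB.equivProd (β : Fragment) : KB β ≃ List (Concept β × Concept β) × List Assertion where
  toFun K := (K.tbox, K.abox)
  invFun p := ⟨p.1, p.2⟩
  left_inv _ := rfl
  right_inv _ := rfl

instance (β : Fragment) : Primcodable (KB β) := Primcodable.ofEquiv _ (KB.equivProd β)

end TDL

/-! The halting problem of a fixed counter machine is reduced to unsatisfiability, by one
construction for both fragments. A configuration is an object `x`, and the contents `c` of its
registers are stored in time: role edges named after the state enter `x` at the moments `mark c 0 <
… < mark c K`, whose successive gaps are `c i + 1`. Incrementing or decrementing register `i` shifts
all marks after the `i`-th by one moment, and a test for zero asks whether mark `i + 1` comes right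
after mark `i`.

The object must know its marks. Every moment of an incoming edge is required to be the first moment
of one of `K + 1` atoms that are nested and preserved in time. The `K + 1` marks are distinct, so
they use up all the atoms, in the right order (`eq_of_first_moments`,
`Machine.Represents.mem_label`). The object must also pass the new marks on to a single successor:
`≥ 2 ◇*P ⊑ ⊥` forces edges that leave at different moments to end in the same object. The operator
`◇*` makes the state visible at all moments, and a rigid role does the same for the outcome of a
test. Shifts by one moment are definable in both fragments for concepts that hold at exactly one
moment.

Hence every model contains the run of the machine, which cannot halt (`Machine.Represents.step`);
conversely an infinite run is turned into a model on the integers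
(`Machine.satisfiable_of_ne_halt`). The machine comes from a loop program for a universal partial
recursive function (`exists_counterMachine`), and its input occurs only in the ABox. -/

namespace TDL

open Function (update)

/-! ### Counter programs -/

/-- Programs over registers holding natural numbers; `loop i p` decrements register `i` and runs
`p` as long as register `i` is not zero. -/
inductive Prog : Type
  | nop
  | inc (i : ℕ)
  | seq (p q : Prog)
  | loop (i : ℕ) (p : Prog)

namespace Prog

/-- `Run p s t`: started on the register contents `s`, the program `p` terminates with `t`. -/
inductive Run : Prog → (ℕ → ℕ) → (ℕ → ℕ) → Prop
  | nop (s) : Run nop s s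
  | inc (i s) : Run (inc i) s (update s i (s i + 1))
  | seq {p q s u t} : Run p s u → Run q u t → Run (seq p q) s t
  | loop_zero {i p s} : s i = 0 → Run (loop i p) s s
  | loop_succ {i p s u t} : s i ≠ 0 → Run p (update s i (s i - 1)) u → Run (loop i p) u t →
      Run (loop i p) s t

theorem run_nop {s t : ℕ → ℕ} : Run nop s t ↔ t = s :=
  ⟨fun h => by cases h; rfl, fun h => h ▸ Run.nop s⟩

theorem run_inc {i : ℕ} {s t : ℕ → ℕ} : Run (inc i) s t ↔ t = update s i (s i + 1) :=
  ⟨fun h => by cases h; rfl, fun h => h ▸ Run.inc i s⟩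

theorem run_seq {p q : Prog} {s t : ℕ → ℕ} : Run (seq p q) s t ↔ ∃ u, Run p s u ∧ Run q u t :=
  ⟨fun h => by cases h with | seq h₁ h₂ => exact ⟨_, h₁, h₂⟩, fun ⟨_, h₁, h₂⟩ => .seq h₁ h₂⟩

theorem run_loop_zero {i : ℕ} {p : Prog} {s t : ℕ → ℕ} (h : s i = 0) :
    Run (loop i p) s t ↔ t = s := by
  constructor
  · intro hr
    cases hr with
    | loop_zero => rfl
    | loop_succ h' => exact absurd h h'
  · rintro rfl
    exact .loop_zero h

theorem run_loop_succ {i : ℕ} {p : Prog} {s t : ℕ → ℕ} (h : s i ≠ 0) :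
    Run (loop i p) s t ↔ ∃ u, Run p (update s i (s i - 1)) u ∧ Run (loop i p) u t := by
  constructor
  · intro hr
    cases hr with
    | loop_zero h' => exact absurd h' h
    | loop_succ _ h₁ h₂ => exact ⟨_, h₁, h₂⟩
  · rintro ⟨u, h₁, h₂⟩
    exact .loop_succ h h₁ h₂

/-- This allows programs to be executed symbolically: an initial part whose only outcome is known is
replaced by that outcome. -/
theorem run_seq_of {p q : Prog} {s u t : ℕ → ℕ} (h : ∀ t, Run p s t ↔ t = u) :
    Run (seq p q) s t ↔ Run q u t := by
  simp [run_seq, h]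

/-- Sets register `i` to zero. -/
def clear (i : ℕ) : Prog := loop i nop

theorem run_clear (i : ℕ) (s t : ℕ → ℕ) : Run (clear i) s t ↔ t = update s i 0 := by
  generalize hc : s i = c
  induction c generalizing s with
  | zero => rw [clear, run_loop_zero hc, ← hc, Function.update_eq_self]
  | succ c ih =>
    rw [clear, run_loop_succ (by omega)]
    simp only [run_nop, exists_eq_left]
    rw [← clear, ih _ (by simp [hc]), Function.update_idem]

/-- Adds register `i` to register `j`, and clears register `i`. -/
def move (i j : ℕ) : Prog := loop i (inc j)

theorem run_move {i j : ℕ} (hij : i ≠ j) (s t : ℕ → ℕ) :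
    Run (move i j) s t ↔ t = update (update s j (s j + s i)) i 0 := by
  generalize hc : s i = c
  induction c generalizing s with
  | zero =>
    rw [move, run_loop_zero hc, add_zero, Function.update_eq_self, ← hc, Function.update_eq_self]
  | succ c ih =>
    rw [move, run_loop_succ (by omega)]
    simp only [run_inc, exists_eq_left]
    rw [← move, ih _ (by simp [hc, hij])]
    apply Eq.congr_right
    funext r
    simp only [Function.update_apply]
    grind

/-- Adds register `i` to register `j`, with `k` as an auxiliary register. -/
def copy (i j k : ℕ) : Prog := seq (loop i (seq (inc j) (inc k))) (move k i)

theorem run_copy {i j k : ℕ} (hij : i ≠ j) (hik : i ≠ k) (hjk : j ≠ k) {s : ℕ → ℕ}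
    (hk : s k = 0) (t : ℕ → ℕ) : Run (copy i j k) s t ↔ t = update s j (s j + s i) := by
  have loop_spec : ∀ (c : ℕ) (s t : ℕ → ℕ), s i = c → (Run (loop i (seq (inc j) (inc k))) s t ↔
      t = update (update (update s j (s j + c)) k (s k + c)) i 0) := by
    intro c
    induction c with
    | zero =>
      intro s t hc
      rw [run_loop_zero hc, add_zero, add_zero, Function.update_eq_self, Function.update_eq_self,
        ← hc, Function.update_eq_self]
    | succ c ih =>
      intro s t hc
      rw [run_loop_succ (by omega)]
      simp only [run_seq, run_inc, exists_eq_left]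
      rw [ih _ _ (by simp [hc, hij, hik])]
      apply Eq.congr_right
      funext r
      simp only [Function.update_apply]
      grind
  rw [copy, run_seq_of fun t => loop_spec _ s t rfl, run_move hik.symm]
  apply Eq.congr_right
  funext r
  simp only [Function.update_apply]
  grind

/-! ### Programs for the partial recursive functions -/

/-- A vector function is computable by programs that read their arguments from given registers,
write the value to a register holding zero, and leave all other registers as they were; the
registers from `b` on are free for auxiliary use. -/
def Computes {n : ℕ} (f : List.Vector ℕ n →. ℕ) : Prop :=
  ∀ (ins : Fin n → ℕ) (out b : ℕ), (∀ i, ins i < b) → out < b → (∀ i, ins i ≠ out) →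
    ∃ p, ∀ s : ℕ → ℕ, (∀ r, b ≤ r → s r = 0) → s out = 0 → ∀ t,
      Run p s t ↔ ∃ v ∈ f (List.Vector.ofFn fun i => s (ins i)), t = update s out v

theorem Computes.total {n : ℕ} {f : List.Vector ℕ n → ℕ} (hf : Computes (f : List.Vector ℕ n →. ℕ))
    (ins : Fin n → ℕ) (out b : ℕ) (hb : ∀ i, ins i < b) (hout : out < b) (hne : ∀ i, ins i ≠ out) :
    ∃ p, ∀ s : ℕ → ℕ, (∀ r, b ≤ r → s r = 0) → s out = 0 → ∀ t,
      Run p s t ↔ t = update s out (f (List.Vector.ofFn fun i => s (ins i))) := by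
  obtain ⟨p, hp⟩ := hf ins out b hb hout hne
  exact ⟨p, fun s h₁ h₂ t => by simp [hp s h₁ h₂ t]⟩

theorem Computes.of_total {n : ℕ} {f : List.Vector ℕ n → ℕ}
    (h : ∀ (ins : Fin n → ℕ) (out b : ℕ), (∀ i, ins i < b) → out < b → (∀ i, ins i ≠ out) →
      ∃ p, ∀ s : ℕ → ℕ, (∀ r, b ≤ r → s r = 0) → s out = 0 → ∀ t,
        Run p s t ↔ t = update s out (f (List.Vector.ofFn fun i => s (ins i)))) :
    Computes (f : List.Vector ℕ n →. ℕ) := fun ins out b hb hout hne => by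
  obtain ⟨p, hp⟩ := h ins out b hb hout hne
  exact ⟨p, fun s h₁ h₂ t => by simp [hp s h₁ h₂ t]⟩

theorem computes_zero : Computes ((fun _ => 0 : List.Vector ℕ 0 → ℕ) : List.Vector ℕ 0 →. ℕ) := by
  refine .of_total fun ins out b _ _ _ => ⟨nop, fun s _ h t => ?_⟩
  rw [run_nop, ← h, Function.update_eq_self]

theorem computes_get {n : ℕ} (i : Fin n) :
    Computes ((fun v => v.get i : List.Vector ℕ n → ℕ) : List.Vector ℕ n →. ℕ) := by
  refine .of_total fun ins out b hb hout hne => ⟨copy (ins i) out b, fun s hs h t => ?_⟩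
  rw [run_copy (hne i) (hb i).ne hout.ne (hs b le_rfl), h, zero_add, List.Vector.get_ofFn]

theorem computes_succ :
    Computes ((fun v => Nat.succ v.head : List.Vector ℕ 1 → ℕ) : List.Vector ℕ 1 →. ℕ) := by
  refine .of_total fun ins out b hb hout hne =>
    ⟨seq (copy (ins 0) out b) (inc out), fun s hs h t => ?_⟩
  rw [run_seq_of (run_copy (hne 0) (hb 0).ne hout.ne (hs b le_rfl)), run_inc]
  simp [h, ← List.Vector.get_zero]

/-- Register contents up to `b`, followed by the entries of a list and zeros. -/
def block (b : ℕ) (l : List ℕ) (s : ℕ → ℕ) : ℕ → ℕ :=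
  fun r => if r < b then s r else l.getD (r - b) 0

/-- The values go to the registers from `b` on. The first one takes `b`, and the induction
hypothesis is used with the free registers starting at `b + 1`. With `mOfFn`, one undefined value
makes the whole vector undefined, just as one diverging part makes the sequence diverge. -/
theorem Computes.sequence {m n : ℕ} {g : Fin n → List.Vector ℕ m →. ℕ} (hg : ∀ i, Computes (g i))
    (ins : Fin m → ℕ) (b : ℕ) (hb : ∀ i, ins i < b) :
    ∃ p, ∀ s : ℕ → ℕ, (∀ r, b ≤ r → s r = 0) → ∀ t, Run p s t ↔
      ∃ w ∈ List.Vector.mOfFn fun i => g i (List.Vector.ofFn fun i => s (ins i)),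
        t = block b w.toList s := by
  induction n generalizing b with
  | zero =>
    refine ⟨nop, fun s hs t => ?_⟩
    have : block b [] s = s := by
      funext r
      simp only [block, List.getD_nil]
      split_ifs with h
      · rfl
      · exact (hs r (by omega)).symm
    simp [List.Vector.mOfFn, run_nop, this, pure]
  | succ n ih =>
    obtain ⟨p, hp⟩ := hg 0 ins b (b + 1) (fun i => (hb i).trans b.lt_succ_self) b.lt_succ_self
      (fun i => (hb i).ne)
    obtain ⟨q, hq⟩ := ih (fun i => hg i.succ) (b + 1) (fun i => (hb i).trans b.lt_succ_self)
    refine ⟨seq p q, fun s hs t => ?_⟩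
    have hblock : ∀ (a : ℕ) (w : List.Vector ℕ n),
        block (b + 1) w.toList (update s b a) = block b (a ::ᵥ w).toList s := by
      intro a w
      funext r
      simp only [block, List.Vector.toList_cons]
      rcases lt_trichotomy r b with h | rfl | h
      · rw [if_pos (by omega), if_pos h, Function.update_of_ne h.ne]
      · simp
      · rw [if_neg (by omega), if_neg (by omega)]
        obtain ⟨k, rfl⟩ := Nat.exists_eq_add_of_lt h
        rw [show b + k + 1 - (b + 1) = k by omega, show b + k + 1 - b = k + 1 by omega,
          List.getD_cons_succ]
    have hins : ∀ a i, update s b a (ins i) = s (ins i) := fun a i =>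
      Function.update_of_ne (hb i).ne _ _
    have hq' : ∀ a t, Run q (update s b a) t ↔
        ∃ w ∈ List.Vector.mOfFn fun i => g (Fin.succ i) (List.Vector.ofFn fun i => s (ins i)),
          t = block b (a ::ᵥ w).toList s := by
      intro a t
      rw [hq (update s b a) (fun r hr => by
        rw [Function.update_of_ne (by omega), hs r (by omega)])]
      simp only [hins, hblock]
    rw [run_seq]
    simp only [hp s (fun r hr => hs r (by omega)) (hs b le_rfl)]
    simp only [List.Vector.mOfFn, pure, Part.bind_eq_bind, Part.mem_bind_iff, Part.mem_some_iff]
    constructor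
    · rintro ⟨u, ⟨a, ha, rfl⟩, hr⟩
      obtain ⟨w, hw, rfl⟩ := (hq' a t).1 hr
      exact ⟨_, ⟨a, ha, w, hw, rfl⟩, rfl⟩
    · rintro ⟨_, ⟨a, ha, w, hw, rfl⟩, rfl⟩
      exact ⟨_, ⟨a, ha, rfl⟩, (hq' a _).2 ⟨w, hw, rfl⟩⟩

/-- Clears the registers `b, …, b + n - 1`. -/
def clearBlock (b : ℕ) : ℕ → Prog
  | 0 => nop
  | n + 1 => seq (clear (b + n)) (clearBlock b n)

theorem run_clearBlock (b n : ℕ) (s t : ℕ → ℕ) :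
    Run (clearBlock b n) s t ↔ t = fun r => if b ≤ r ∧ r < b + n then 0 else s r := by
  induction n generalizing s with
  | zero =>
    rw [clearBlock, run_nop]
    apply Eq.congr_right
    funext r
    rw [if_neg (by omega)]
  | succ n ih =>
    rw [clearBlock, run_seq_of (run_clear _ _), ih]
    apply Eq.congr_right
    funext r
    simp only [Function.update_apply]
    grind

/-- The program for `f` reads its arguments from the block at `b` and has its free registers from `b
+ n` on. Clearing the block afterwards leaves `out` as the only changed register. -/
theorem Computes.comp {m n : ℕ} {f : List.Vector ℕ n →. ℕ} {g : Fin n → List.Vector ℕ m →. ℕ}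
    (hf : Computes f) (hg : ∀ i, Computes (g i)) :
    Computes fun v => (List.Vector.mOfFn fun i => g i v) >>= f := by
  intro ins out b hb hout hne
  obtain ⟨p, hp⟩ := Computes.sequence hg ins b hb
  obtain ⟨q, hq⟩ := hf (fun i => b + i) out (b + n) (fun i => by omega) (by omega)
    (fun i => by omega)
  refine ⟨seq p (seq q (clearBlock b n)), fun s hs h0 t => ?_⟩
  have key : ∀ (w : List.Vector ℕ n) t, Run (seq q (clearBlock b n)) (block b w.toList s) t ↔
      ∃ v ∈ f w, t = update s out v := by
    intro w t
    have hw : (List.Vector.ofFn fun i : Fin n => block b w.toList s (b + i)) = w := by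
      ext i
      rw [List.Vector.get_ofFn, block, if_neg (by omega), Nat.add_sub_cancel_left,
        List.Vector.get_eq_get_toList, List.getD_eq_getElem _ _ (by simp)]
      rfl
    have hclear : ∀ v, (fun r => if b ≤ r ∧ r < b + n then 0
        else update (block b w.toList s) out v r) = update s out v := by
      intro v
      funext r
      by_cases hr : r < b
      · rw [if_neg (by omega)]
        simp only [Function.update_apply, block, if_pos hr]
      · have hne : r ≠ out := by omega
        rw [Function.update_of_ne hne, Function.update_of_ne hne, hs r (by omega)]
        split_ifs with h
        · rfl
        · rw [block, if_neg hr, List.getD_eq_default _ _ (by simp; omega)]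
    have hq' := hq (block b w.toList s) (fun r hr => by
      rw [block, if_neg (by omega), List.getD_eq_default _ _ (by simp; omega)])
      (by rw [block, if_pos hout, h0])
    simp only [hw] at hq'
    simp only [run_seq, run_clearBlock, hq']
    constructor
    · rintro ⟨u, ⟨v, hv, rfl⟩, rfl⟩
      exact ⟨v, hv, hclear v⟩
    · rintro ⟨v, hv, rfl⟩
      exact ⟨_, ⟨v, hv, rfl⟩, (hclear v).symm⟩
  rw [run_seq]
  simp only [hp s hs]
  constructor
  · rintro ⟨u, ⟨w, hw, rfl⟩, hr⟩
    obtain ⟨v, hv, rfl⟩ := (key w t).1 hr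
    exact ⟨v, Part.mem_bind_iff.2 ⟨w, hw, hv⟩, rfl⟩
  · rintro ⟨v, hv', rfl⟩
    obtain ⟨w, hw, hv⟩ := Part.mem_bind_iff.1 hv'
    exact ⟨_, ⟨w, hw, rfl⟩, (key w _).2 ⟨v, hv, rfl⟩⟩

theorem ofFn_cases {n : ℕ} (a : ℕ) (ins : Fin n → ℕ) (s : ℕ → ℕ) :
    (List.Vector.ofFn fun i => s (Fin.cases (motive := fun _ => ℕ) a ins i)) =
      s a ::ᵥ List.Vector.ofFn fun i => s (ins i) := by
  ext i
  cases i using Fin.cases <;> simp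

/-- Register `b` counts down from the recursion argument and `b + 1` counts up. The loop invariant
is that `out` holds the recursive value at the index in `b + 1`; the next value is computed in `b +
2` and then replaces it. -/
theorem Computes.prec {n : ℕ} {f : List.Vector ℕ n → ℕ} {g : List.Vector ℕ (n + 2) → ℕ}
    (hf : Computes (f : List.Vector ℕ n →. ℕ)) (hg : Computes (g : List.Vector ℕ (n + 2) →. ℕ)) :
    Computes ((fun v => v.head.rec (f v.tail) fun y IH => g (y ::ᵥ IH ::ᵥ v.tail) :
      List.Vector ℕ (n + 1) → ℕ) : List.Vector ℕ (n + 1) →. ℕ) := by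
  refine .of_total fun ins out b hb hout hne => ?_
  have hb0 := hb 0
  have hne0 := hne 0
  obtain ⟨p, hp⟩ := hf.total (fun i => ins i.succ) out b (fun i => hb _) hout (fun i => hne _)
  obtain ⟨q, hq⟩ := hg.total (Fin.cases (b + 1) (Fin.cases out fun i => ins i.succ)) (b + 2) (b + 3)
    (Fin.forall_fin_succ.2 ⟨by change b + 1 < b + 3; omega,
      Fin.forall_fin_succ.2 ⟨by change out < b + 3; omega, fun i => by
        have := hb i.succ
        change ins i.succ < b + 3
        omega⟩⟩)
    (by omega)
    (Fin.forall_fin_succ.2 ⟨by change b + 1 ≠ b + 2; omega,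
      Fin.forall_fin_succ.2 ⟨by change out ≠ b + 2; omega, fun i => by
        have := hb i.succ
        change ins i.succ ≠ b + 2
        omega⟩⟩)
  set body : Prog := seq q (seq (clear out) (seq (move (b + 2) out) (inc (b + 1)))) with hbody
  refine ⟨seq p (seq (copy (ins 0) b (b + 1)) (seq (loop b body) (clear (b + 1)))),
    fun s hs h0 t => ?_⟩
  set v := List.Vector.ofFn fun i => s (ins (Fin.succ i)) with hv
  have hbody_run : ∀ (u : ℕ → ℕ), (∀ r, b + 2 ≤ r → u r = 0) → (∀ i : Fin n, u (ins i.succ) =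
      s (ins i.succ)) → ∀ t, Run body u t ↔
        t = update (update u out (g (u (b + 1) ::ᵥ u out ::ᵥ v))) (b + 1) (u (b + 1) + 1) := by
    intro u hu hins t
    rw [hbody, run_seq_of (hq u (fun r hr => hu r (by omega)) (hu _ le_rfl)),
      run_seq_of (run_clear _ _), run_seq_of (run_move (by omega) _), run_inc]
    simp only [ofFn_cases, hins, ← hv]
    apply Eq.congr_right
    have h2 := hu (b + 2) le_rfl
    funext r
    simp only [Function.update_apply]
    grind
  have hloop : ∀ (c : ℕ) (u : ℕ → ℕ), u b = c → (∀ r, b + 2 ≤ r → u r = 0) →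
      (∀ i : Fin n, u (ins i.succ) = s (ins i.succ)) →
      u out = Nat.rec (f v) (fun y IH => g (y ::ᵥ IH ::ᵥ v)) (u (b + 1)) → ∀ t,
      (Run (loop b body) u t ↔ t = update (update (update u out
        (Nat.rec (f v) (fun y IH => g (y ::ᵥ IH ::ᵥ v)) (u (b + 1) + c))) b 0) (b + 1)
          (u (b + 1) + c)) := by
    intro c
    induction c with
    | zero =>
      intro u hc _ _ ho t
      rw [run_loop_zero hc, add_zero, ← ho, Function.update_eq_self, ← hc, Function.update_eq_self,
        Function.update_eq_self]
    | succ c ih =>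
      intro u hc hu hins ho t
      rw [run_loop_succ (by omega)]
      have hins' : ∀ (i : Fin n) x y z, update (update (update u b x) out y) (b + 1) z (ins i.succ)
          = s (ins i.succ) := fun i x y z => by
        have h1 := hb i.succ
        rw [Function.update_of_ne (by omega), Function.update_of_ne (hne _),
          Function.update_of_ne (by omega), hins]
      simp only [hbody_run (update u b (u b - 1))
        (fun r hr => by rw [Function.update_of_ne (by omega), hu r hr])
        (fun i => by rw [Function.update_of_ne (hb _).ne, hins]), exists_eq_left]
      have hy : update u b (u b - 1) (b + 1) = u (b + 1) := Function.update_of_ne (by omega) _ _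
      have ho' : update u b (u b - 1) out = u out := Function.update_of_ne (by omega) _ _
      rw [hy, ho', ih]
      · simp only [Function.update_self, show u (b + 1) + 1 + c = u (b + 1) + (c + 1) by omega]
        apply Eq.congr_right
        funext r
        simp only [Function.update_apply]
        grind
      · rw [Function.update_of_ne (by omega), Function.update_of_ne (by omega),
          Function.update_self, hc, Nat.add_sub_cancel]
      · intro r hr
        rw [Function.update_of_ne (by omega), Function.update_of_ne (by omega),
          Function.update_of_ne (by omega), hu r hr]
      · exact fun i => hins' i _ _ _
      · rw [Function.update_of_ne (by omega), Function.update_self, Function.update_self, ho]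
  rw [run_seq_of (hp s hs h0), run_seq_of (run_copy (by omega) (by omega) (by omega)
      (by rw [Function.update_of_ne (by omega), hs _ (by omega)])),
    run_seq_of (hloop (s (ins 0)) _ _ _ _ _), run_clear]
  · have hsb := hs b le_rfl
    have hsb' := hs (b + 1) (by omega)
    have e1 : (List.Vector.ofFn fun i => s (ins i)).head = s (ins 0) := by
      rw [← List.Vector.get_zero, List.Vector.get_ofFn]
    have e2 : (List.Vector.ofFn fun i => s (ins i)).tail = v := rfl
    have e3 : ∀ x y, update (update s out x) b y (b + 1) + s (ins 0) = s (ins 0) := fun x y => by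
      rw [Function.update_of_ne (by omega), Function.update_of_ne (by omega), hsb', zero_add]
    rw [e1, e2, e3]
    apply Eq.congr_right
    funext r
    simp only [Function.update_apply]
    grind
  · rw [Function.update_self, Function.update_of_ne (by omega), hs b le_rfl,
      Function.update_of_ne (by omega), zero_add]
  · intro r hr
    rw [Function.update_of_ne (by omega), Function.update_of_ne (by omega), hs r (by omega)]
  · intro i
    rw [Function.update_of_ne (hb _).ne, Function.update_of_ne (hne _)]
  · rw [Function.update_of_ne (by omega), Function.update_self, Function.update_of_ne (by omega),
      Function.update_of_ne (by omega), hs (b + 1) (by omega)]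
    rfl

/-- Register `b` holds the candidate and `b + 1` the value of `f` on it, so that looping on `b + 1`
searches for the first zero. -/
theorem Computes.rfind {n : ℕ} {f : List.Vector ℕ (n + 1) → ℕ}
    (hf : Computes (f : List.Vector ℕ (n + 1) →. ℕ)) :
    Computes fun v => Nat.rfind fun n => Part.some (decide (f (n ::ᵥ v) = 0)) := by
  intro ins out b hb hout hne
  obtain ⟨p, hp⟩ := hf.total (Fin.cases b ins) (b + 1) (b + 2)
    (fun i => by
      cases i using Fin.cases with
      | zero => simp
      | succ i => have := hb i; simpa using by omega)
    (by omega)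
    (fun i => by
      cases i using Fin.cases with
      | zero => simp
      | succ i => have := hb i; simpa using by omega)
  set body : Prog := seq (clear (b + 1)) (seq (inc b) p) with hbody
  refine ⟨seq p (seq (loop (b + 1) body) (move b out)), fun s hs h0 t => ?_⟩
  set v := List.Vector.ofFn fun i => s (ins i) with hv
  -- the register contents while the value `y` is being tested
  set st : ℕ → ℕ → ℕ := fun y => update (update s b y) (b + 1) (f (y ::ᵥ v)) with hst
  have hp' : ∀ y t, Run p (update s b y) t ↔ t = st y := by
    intro y t
    rw [hp _ (fun r hr => by rw [Function.update_of_ne (by omega), hs r (by omega)])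
      (by rw [Function.update_of_ne (by omega), hs _ (by omega)]), ofFn_cases, Function.update_self]
    have : ∀ i, update s b y (ins i) = s (ins i) := fun i => Function.update_of_ne (hb i).ne _ _
    simp only [this, ← hv, hst]
  have hst1 : ∀ y, st y (b + 1) = f (y ::ᵥ v) := fun y => Function.update_self ..
  have hbody_run : ∀ y x t, Run body (update (st y) (b + 1) x) t ↔ t = st (y + 1) := by
    intro y x t
    rw [hbody, run_seq_of (run_clear _ _), run_seq_of fun t => run_inc, ← hp']
    apply Eq.to_iff
    congr 1
    have hsb := hs (b + 1) (by omega)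
    funext r
    simp only [hst, Function.update_apply]
    grind
  have hloop_succ : ∀ y t, f (y ::ᵥ v) ≠ 0 →
      (Run (loop (b + 1) body) (st y) t ↔ Run (loop (b + 1) body) (st (y + 1)) t) := by
    intro y t hy
    rw [run_loop_succ (by rwa [hst1])]
    simp only [hbody_run, exists_eq_left]
  have hback : ∀ k y t, f ((y + k) ::ᵥ v) = 0 → (∀ m < k, f ((y + m) ::ᵥ v) ≠ 0) →
      (Run (loop (b + 1) body) (st y) t ↔ t = st (y + k)) := by
    intro k
    induction k with
    | zero => intro y t h _; exact run_loop_zero (by rwa [hst1])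
    | succ k ih =>
      intro y t h h'
      rw [hloop_succ y t (h' 0 (by omega)), ih (y + 1) t (by rwa [add_right_comm, add_assoc])
        (fun m hm => by rw [add_right_comm, add_assoc]; exact h' _ (by omega)),
        add_right_comm, add_assoc]
  -- Termination implies that a zero exists. The induction is on the derivation of the run, so the
  -- program and the initial contents are generalised; each iteration raises the candidate by one.
  have hforw : ∀ q u t, Run q u t → q = loop (b + 1) body → ∀ y, u = st y →
      ∃ k, f ((y + k) ::ᵥ v) = 0 := by
    intro q u t hr
    induction hr with
    | nop | inc | seq => intro h; cases h
    | loop_zero h0 =>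
      rintro h y rfl
      cases h
      exact ⟨0, by rwa [hst1] at h0⟩
    | loop_succ h0 h1 h2 ih1 ih2 =>
      rintro h y rfl
      cases h
      rw [hbody_run] at h1
      obtain ⟨k, hk⟩ := ih2 rfl (y + 1) h1
      exact ⟨k + 1, by rwa [← add_assoc, add_right_comm]⟩
  have hmove : ∀ y t, f (y ::ᵥ v) = 0 → (Run (move b out) (st y) t ↔ t = update s out y) := by
    intro y t hy
    rw [run_move (by omega)]
    have hsb := hs (b + 1) (by omega)
    have hsb' := hs b (by omega)
    apply Eq.congr_right
    funext r
    simp only [hst, Function.update_apply, hy]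
    grind
  have hs0 : update s b 0 = s := by rw [← hs b le_rfl, Function.update_eq_self]
  have hp0 := hp' 0
  rw [hs0] at hp0
  rw [run_seq_of hp0, run_seq]
  have hmem : ∀ y, (y ∈ Nat.rfind fun n => Part.some (decide (f (n ::ᵥ v) = 0))) ↔
      f (y ::ᵥ v) = 0 ∧ ∀ m < y, f (m ::ᵥ v) ≠ 0 := by
    intro y
    refine Nat.mem_rfind.trans ?_
    simp
  have hmem' : ∀ y, f (y ::ᵥ v) = 0 → (∀ m < y, f (m ::ᵥ v) ≠ 0) → ∀ t,
      (Run (loop (b + 1) body) (st 0) t ↔ t = st y) := by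
    intro y h1 h2 t
    simpa using hback y 0 t (by simpa using h1) (by simpa using h2)
  constructor
  · rintro ⟨u, h1, h2⟩
    have hex : ∃ k, f (k ::ᵥ v) = 0 := by simpa using hforw _ _ _ h1 rfl 0 rfl
    classical
    have hmin := Nat.find_spec hex
    have hmin' : ∀ m < Nat.find hex, f (m ::ᵥ v) ≠ 0 := fun m hm => Nat.find_min hex hm
    rw [hmem' _ hmin hmin'] at h1
    subst h1
    exact ⟨_, (hmem _).2 ⟨hmin, hmin'⟩, (hmove _ _ hmin).1 h2⟩
  · rintro ⟨y, hy, rfl⟩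
    obtain ⟨h1, h2⟩ := (hmem y).1 hy
    exact ⟨_, (hmem' y h1 h2 _).2 rfl, (hmove y _ h1).2 rfl⟩

theorem computes_of_primrec {n : ℕ} {f : List.Vector ℕ n → ℕ} (hf : Nat.Primrec' f) :
    Computes (f : List.Vector ℕ n →. ℕ) := by
  induction hf with
  | zero => exact computes_zero
  | succ => exact computes_succ
  | get i => exact computes_get i
  | @comp m n f g _ _ ihf ihg =>
    refine (congrArg Computes ?_).mpr (Computes.comp ihf ihg)
    funext v
    simp only [PFun.coe_val, Vector.mOfFn_part_some]
    exact (Part.bind_some _ _).symm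
  | prec _ _ ihf ihg => exact ihf.prec ihg

theorem computes_of_partrec {n : ℕ} {f : List.Vector ℕ n →. ℕ} (hf : Nat.Partrec' f) :
    Computes f := by
  induction hf with
  | prim h => exact computes_of_primrec h
  | comp g _ _ ihf ihg => exact ihf.comp ihg
  | rfind _ ih => exact ih.rfind

/-- There is a program whose halting problem is undecidable. -/
theorem exists_not_computablePred_run :
    ∃ p : Prog, ¬ ComputablePred fun m : ℕ => ∃ t, Run p (update (fun _ => 0) 0 m) t := by
  -- The universal function, with the code as argument and evaluation at 0: termination on the input
  -- `m` is the halting problem at 0 for the code `m`.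
  have hf : Partrec fun v : List.Vector ℕ 1 =>
      (Nat.Partrec.Code.ofNatCode v.head).eval 0 :=
    Nat.Partrec.Code.eval_part.comp
      ((Computable.ofNat Nat.Partrec.Code).comp Computable.vector_head) (Computable.const 0)
  obtain ⟨p, hp⟩ := computes_of_partrec (Nat.Partrec'.of_part hf) (fun _ => 0) 1 2 (by simp)
    (by simp) (by simp)
  refine ⟨p, fun h => ComputablePred.halting_problem 0 ?_⟩
  have h' : ComputablePred fun c : Nat.Partrec.Code =>
      ∃ t, Run p (update (fun _ => 0) 0 (Encodable.encode c)) t :=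
    ComputablePred.computable_of_manyOneReducible ⟨_, Computable.encode, fun _ => Iff.rfl⟩ h
  refine h'.of_eq fun c => ?_
  rw [Part.dom_iff_mem]
  have h1 : ∀ r, 2 ≤ r → update (fun _ => 0) 0 (Encodable.encode c) r = 0 := fun r hr =>
    Function.update_of_ne (by omega) _ _
  have h2 : Nat.Partrec.Code.ofNatCode (Encodable.encode c) = c := Denumerable.ofNat_encode c
  simp only [hp _ h1 (by simp)]
  simp only [← List.Vector.get_zero, List.Vector.get_ofFn, Function.update_self, h2]
  exact ⟨fun ⟨_, v, hv, _⟩ => ⟨v, hv⟩, fun ⟨v, hv⟩ => ⟨_, v, hv, rfl⟩⟩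

end Prog

/-! ### Counter machines -/

/-- Instructions of counter machines with states in `σ`; `dec i q₁ q₀` decrements register `i` and
continues in `q₁` if the register is not zero, and continues in `q₀` otherwise. -/
inductive Instr (σ : Type) : Type
  | halt
  | goto (q : σ)
  | inc (i : ℕ) (q : σ)
  | dec (i : ℕ) (q₁ q₀ : σ)

namespace Instr

variable {σ : Type}

/-- The states to which an instruction may lead. -/
def succs : Instr σ → List σ
  | halt => []
  | goto q => [q]
  | inc _ q => [q]
  | dec _ q₁ q₀ => [q₁, q₀]

/-- A strict upper bound for the registers used by an instruction. -/
def bound : Instr σ → ℕ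
  | halt => 0
  | goto _ => 0
  | inc i _ => i + 1
  | dec i _ _ => i + 1

/-- The effect of an instruction on a configuration. -/
def exec : Instr σ → σ × (ℕ → ℕ) → σ × (ℕ → ℕ)
  | halt, c => c
  | goto q, c => (q, c.2)
  | inc i q, c => (q, update c.2 i (c.2 i + 1))
  | dec i q₁ q₀, c => if c.2 i = 0 then (q₀, c.2) else (q₁, update c.2 i (c.2 i - 1))

theorem exec_mem (a : Instr σ) (c : σ × (ℕ → ℕ)) (ha : a ≠ halt) : (a.exec c).1 ∈ a.succs := by
  cases a with
  | halt => exact absurd rfl ha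
  | goto | inc => simp [exec, succs]
  | dec => simp only [exec, succs]; split_ifs <;> simp

/-- A step of the counter machine with program `δ`. -/
def step (δ : σ → Instr σ) (c : σ × (ℕ → ℕ)) : σ × (ℕ → ℕ) := (δ c.1).exec c

end Instr

/-! ### Simulation of programs by counter machines -/

namespace Prog

/-- Programs as a counter machine, the states of which are the lists of the programs that are still
to be run. -/
def instr : List Prog → Instr (List Prog)
  | [] => .halt
  | nop :: k => .goto k
  | inc i :: k => .inc i k
  | seq p q :: k => .goto (p :: q :: k)
  | loop i p :: k => .dec i (p :: loop i p :: k) k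

/-- The states in which a program is run, up to the continuation `k`. -/
def states : Prog → List Prog → List (List Prog)
  | nop, k => [nop :: k]
  | inc i, k => [inc i :: k]
  | seq p q, k => (seq p q :: k) :: (states p (q :: k) ++ states q k)
  | loop i p, k => (loop i p :: k) :: states p (loop i p :: k)

theorem cons_mem_states (p : Prog) (k : List Prog) : p :: k ∈ states p k := by
  cases p <;> simp [states]

/-- Although the type of states is infinite, a program visits only finitely many: control leaves
`states p k` only by reaching `k`. -/
theorem succs_subset_states (p : Prog) (k : List Prog) :
    ∀ q ∈ states p k, ∀ q' ∈ (instr q).succs, q' ∈ states p k ∨ q' = k := by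
  induction p generalizing k with
  | nop | inc => simp [states, instr, Instr.succs]
  | seq p q ihp ihq =>
    have hp := cons_mem_states p (q :: k)
    have hq := cons_mem_states q k
    intro r hr r' hr'
    simp only [states, List.mem_cons, List.mem_append] at hr ⊢
    rcases hr with rfl | hr | hr
    · simp only [instr, Instr.succs, List.mem_singleton] at hr'
      subst hr'
      exact .inl (.inr (.inl hp))
    · rcases ihp _ r hr r' hr' with h | rfl
      · exact .inl (.inr (.inl h))
      · exact .inl (.inr (.inr hq))
    · rcases ihq _ r hr r' hr' with h | h
      · exact .inl (.inr (.inr h))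
      · exact .inr h
  | loop i p ih =>
    have hp := cons_mem_states p (loop i p :: k)
    intro r hr r' hr'
    simp only [states, List.mem_cons] at hr ⊢
    rcases hr with rfl | hr
    · simp only [instr, Instr.succs, List.mem_cons, List.not_mem_nil, or_false] at hr'
      rcases hr' with rfl | rfl
      · exact .inl (.inr hp)
      · exact .inr rfl
    · rcases ih _ r hr r' hr' with h | h
      · exact .inl (.inr h)
      · exact .inl (.inl h)

theorem Run.exists_iterate_step {p : Prog} {s t : ℕ → ℕ} (h : Run p s t) (k : List Prog) :
    ∃ n, (Instr.step instr)^[n] (p :: k, s) = (k, t) := by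
  induction h generalizing k with
  | nop => exact ⟨1, rfl⟩
  | inc => exact ⟨1, rfl⟩
  | @seq p q _ _ _ _ _ ih₁ ih₂ =>
    obtain ⟨n₁, h₁⟩ := ih₁ (q :: k)
    obtain ⟨n₂, h₂⟩ := ih₂ k
    exact ⟨n₂ + n₁ + 1, by
      rw [Function.iterate_succ_apply, Function.iterate_add_apply, ← h₂, ← h₁]; rfl⟩
  | loop_zero h => exact ⟨1, by simp [Instr.step, instr, Instr.exec, h]⟩
  | @loop_succ i p s u t h _ _ ih₁ ih₂ =>
    obtain ⟨n₁, h₁⟩ := ih₁ (loop i p :: k)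
    obtain ⟨n₂, h₂⟩ := ih₂ k
    exact ⟨n₂ + n₁ + 1, by
      rw [Function.iterate_succ_apply, Function.iterate_add_apply, ← h₂, ← h₁]
      simp [Instr.step, instr, Instr.exec, h]⟩

/-- A halting computation must finish `p` before it reaches `k`. The bound `m < n` lets the strong
induction apply again to the remaining computation in the cases of `seq` and `loop`. -/
theorem exists_run_of_iterate_step (n : ℕ) (p : Prog) (k : List Prog) (s : ℕ → ℕ)
    (h : ((Instr.step instr)^[n] (p :: k, s)).1 = []) :
    ∃ t, Run p s t ∧ ∃ m < n, ((Instr.step instr)^[m] (k, t)).1 = [] := by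
  induction n using Nat.strong_induction_on generalizing p k s with
  | _ n ih =>
    cases n with
    | zero => simp at h
    | succ n =>
      rw [Function.iterate_succ_apply] at h
      cases p with
      | nop => exact ⟨_, .nop _, n, n.lt_succ_self, h⟩
      | inc i => exact ⟨_, .inc _ _, n, n.lt_succ_self, h⟩
      | seq p q =>
        obtain ⟨u, hu, m, hm, h'⟩ := ih n n.lt_succ_self _ _ _ h
        obtain ⟨t, ht, l, hl, h''⟩ := ih m (by omega) _ _ _ h'
        exact ⟨t, .seq hu ht, l, by omega, h''⟩
      | loop i p =>
        by_cases hs : s i = 0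
        · simp only [Instr.step, instr, Instr.exec, hs, if_true] at h
          exact ⟨_, .loop_zero hs, n, n.lt_succ_self, h⟩
        · simp only [Instr.step, instr, Instr.exec, hs, if_false] at h
          obtain ⟨u, hu, m, hm, h'⟩ := ih n n.lt_succ_self _ _ _ h
          obtain ⟨t, ht, l, hl, h''⟩ := ih m (by omega) _ _ _ h'
          exact ⟨t, .loop_succ hs hu ht, l, by omega, h''⟩

theorem instr_eq_halt {k : List Prog} : instr k = .halt ↔ k = [] := by
  rcases k with _ | ⟨_ | _ | _ | _, _⟩ <;> simp [instr]

theorem exists_run_iff (p : Prog) (s : ℕ → ℕ) :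
    (∃ t, Run p s t) ↔ ∃ n, instr ((Instr.step instr)^[n] ([p], s)).1 = .halt := by
  simp only [instr_eq_halt]
  constructor
  · rintro ⟨t, h⟩
    obtain ⟨n, hn⟩ := h.exists_iterate_step []
    exact ⟨n, by rw [hn]⟩
  · rintro ⟨n, hn⟩
    obtain ⟨t, ht, -⟩ := exists_run_of_iterate_step n p [] s hn
    exact ⟨t, ht⟩

end Prog

/-- There is a finite counter machine whose halting problem is undecidable. -/
theorem exists_counterMachine : ∃ (σ : Type) (δ : σ → Instr σ) (Φ : List σ) (q₀ : σ) (K : ℕ),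
    q₀ ∈ Φ ∧ (∀ q ∈ Φ, ∀ q' ∈ (δ q).succs, q' ∈ Φ) ∧ (∀ q ∈ Φ, (δ q).bound ≤ K) ∧
    ¬ ComputablePred fun m : ℕ =>
      ∃ n, δ ((Instr.step δ)^[n] (q₀, update (fun _ => 0) 0 m)).1 = .halt := by
  obtain ⟨p, hp⟩ := Prog.exists_not_computablePred_run
  -- The state `[]` is added because `p` ends there; the sum of all bounds is a convenient common
  -- bound.
  refine ⟨List Prog, Prog.instr, [] :: Prog.states p [], [p],
    ((([] :: Prog.states p []).map fun q => (Prog.instr q).bound).sum), ?_, ?_, ?_, ?_⟩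
  · exact List.mem_cons_of_mem _ (Prog.cons_mem_states p [])
  · intro q hq q' hq'
    rcases List.mem_cons.1 hq with rfl | hq
    · simp [Prog.instr, Instr.succs] at hq'
    · rcases Prog.succs_subset_states p [] q hq q' hq' with h | rfl
      · exact List.mem_cons_of_mem _ h
      · exact List.mem_cons_self
  · exact fun q hq => List.le_sum_of_mem (List.mem_map_of_mem hq)
  · simpa only [Prog.exists_run_iff] using hp

/-! ### Defined concepts -/

namespace Concept

variable {β : Fragment}

/-- Disjunction of concepts. -/
def or (C D : Concept β) : Concept β := .neg (.inter (.neg C) (.neg D))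

/-- Disjunction of a list of concepts. -/
def disj : List (Concept β) → Concept β
  | [] => .bot
  | C :: l => or C (disj l)

/-- A concept that contains `C` at all moments if and only if `C` is preserved in time. -/
def later : {β : Fragment} → Concept β → Concept β
  | .X, C => .temp .nextF C
  | .FP, C => .temp .boxF C

/-- The first moment of a concept that is preserved in time. -/
def first : {β : Fragment} → Concept β → Concept β
  | .X, C => .inter C (.neg (.temp .nextP C))
  | .FP, C => .inter C (.temp .boxP (.neg C))

/-- The moment after the only moment of a concept.  In the fragment `FP` this is the moment that has
a moment of the concept before it, but none before an earlier moment. -/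
def after : {β : Fragment} → Concept β → Concept β
  | .X, C => .temp .nextP C
  | .FP, C => .inter (.neg (.temp .boxP (.neg C))) (.temp .boxP (.temp .boxP (.neg C)))

/-- The moment before the only moment of a concept. -/
def before : {β : Fragment} → Concept β → Concept β
  | .X, C => .temp .nextF C
  | .FP, C => .inter (.neg (.temp .boxF (.neg C))) (.temp .boxF (.temp .boxF (.neg C)))

end Concept

/-! ### Semantics of the defined concepts -/

namespace Interp

variable {β : Fragment} {I : Interp.{u}} {x : I.Dom}

theorem mem_disj {l : List (Concept β)} {n : ℤ} :
    x ∈ I.concept (Concept.disj l) n ↔ ∃ C ∈ l, x ∈ I.concept C n := by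
  induction l with
  | nil => simp [Concept.disj, concept]
  | cons C l ih =>
    simp only [Concept.disj, Concept.or, concept, Set.mem_compl_iff, Set.mem_inter_iff,
      List.exists_mem_cons_iff, ih]
    rw [not_and_or, not_not, not_not]

theorem mem_atLeast_one {R : Role} {n : ℤ} :
    x ∈ I.concept (.atLeast 1 R : Concept β) n ↔ ∃ y, I.role R n x y := by
  simp only [concept, Set.mem_ofPred_eq, PNat.one_coe, Nat.cast_one,
    Set.one_le_encard_iff_nonempty]
  rfl

theorem atLeast_two_subset_bot {R : Role} {n : ℤ} :
    I.concept (.atLeast 2 R : Concept β) n ⊆ I.concept (.bot : Concept β) n ↔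
      ∀ x y z, I.role R n x y → I.role R n x z → y = z := by
  have h : ∀ s : Set I.Dom, (((2 : ℕ+) : ℕ) : ℕ∞) ≤ s.encard ↔ ¬ s.encard ≤ 1 := fun s => by
    rw [not_le, ← ENat.add_one_le_iff (by simp)]
    rfl
  simp only [concept, Set.subset_empty_iff, Set.eq_empty_iff_forall_notMem, Set.mem_ofPred_eq, h,
    not_not, Set.encard_le_one_iff]

theorem later_iff {C : Concept β} :
    (∀ n, I.concept C n ⊆ I.concept C.later n) ↔
      ∀ x m n, m ≤ n → x ∈ I.concept C m → x ∈ I.concept C n := by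
  cases β with
  | X =>
    simp only [Concept.later, concept, TempOp.ext]
    exact ⟨fun h x m n hmn hm => Int.leInduction hm (fun k _ hk => h k hk) n hmn,
      fun h n x hx => h x n (n + 1) (by omega) hx⟩
  | FP =>
    simp only [Concept.later, concept, TempOp.ext]
    exact ⟨fun h x m n hmn hm => hmn.eq_or_lt.elim (fun e => e ▸ hm) (h m hm n),
      fun h n x hx k hk => h x n k hk.le hx⟩

theorem mem_first {C : Concept β} (h : ∀ m n, m ≤ n → x ∈ I.concept C m → x ∈ I.concept C n)
    {n : ℤ} : x ∈ I.concept C.first n ↔ x ∈ I.concept C n ∧ ∀ k < n, x ∉ I.concept C k := by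
  cases β with
  | X =>
    simp only [Concept.first, concept, TempOp.ext, Set.mem_inter_iff, Set.mem_compl_iff]
    exact and_congr_right fun _ =>
      ⟨fun h' k hk hx => h' (h k (n - 1) (by omega) hx), fun h' => h' _ (by omega)⟩
  | FP =>
    simp only [Concept.first, concept, TempOp.ext, Set.mem_inter_iff, Set.mem_ofPred_eq,
      Set.mem_compl_iff]

/-- In the fragment `FP`, strictness of `□_P` makes `□_P □_P ¬C` at `n` say that `C` fails at all
moments before `n - 1`. Together with `m < n` this leaves only `m = n - 1`. -/
theorem mem_after {C : Concept β} {m : ℤ} (h : ∀ n, x ∈ I.concept C n ↔ n = m) {n : ℤ} :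
    x ∈ I.concept C.after n ↔ n = m + 1 := by
  cases β with
  | X =>
    simp only [Concept.after, concept, TempOp.ext, h]
    omega
  | FP =>
    simp only [Concept.after, concept, TempOp.ext, Set.mem_inter_iff, Set.mem_ofPred_eq,
      Set.mem_compl_iff, h, not_forall, not_not]
    constructor
    · rintro ⟨⟨k, hk, rfl⟩, h'⟩
      by_contra hne
      exact h' (k + 1) (by omega) k (by omega) rfl
    · rintro rfl
      exact ⟨⟨m, by omega, rfl⟩, fun k hk l hl => by omega⟩

theorem mem_before {C : Concept β} {m : ℤ} (h : ∀ n, x ∈ I.concept C n ↔ n = m) {n : ℤ} :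
    x ∈ I.concept C.before n ↔ n = m - 1 := by
  cases β with
  | X =>
    simp only [Concept.before, concept, TempOp.ext, h]
    omega
  | FP =>
    simp only [Concept.before, concept, TempOp.ext, Set.mem_inter_iff, Set.mem_ofPred_eq,
      Set.mem_compl_iff, h, not_forall, not_not]
    constructor
    · rintro ⟨⟨k, hk, rfl⟩, h'⟩
      by_contra hne
      exact h' (k - 1) (by omega) k (by omega) rfl
    · rintro rfl
      exact ⟨⟨m, by omega, rfl⟩, fun k hk l hl => by omega⟩

end Interp

/-! ### Sequences of moments -/

/-- If all members of a strictly increasing sequence of moments are first moments in a decreasing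
sequence of sets of moments, then these are their first moments, in this order. -/
theorem eq_of_first_moments {K : ℕ} {T : ℕ → ℤ → Prop} {p : ℕ → ℤ} (hp : StrictMono p)
    (hT : ∀ i j, i ≤ j → j ≤ K → ∀ n, T j n → T i n)
    (h : ∀ i ≤ K, ∃ j ≤ K, T j (p i) ∧ ∀ k < p i, ¬ T j k) {j : ℕ} (hj : j ≤ K) (n : ℤ) :
    (T j n ∧ ∀ k < n, ¬ T j k) ↔ n = p j := by
  choose! f hfK hfT hf using h
  -- Otherwise set `f (i + 1)` contains set `f i`, and hence the moment `p i`, which precedes its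
  -- first moment `p (i + 1)`.
  have hlt : ∀ i < K, f i < f (i + 1) := fun i hi => by
    by_contra hle
    exact hf (i + 1) hi (p i) (hp i.lt_succ_self)
      (hT _ _ (not_lt.1 hle) (hfK i hi.le) _ (hfT i hi.le))
  -- A strictly increasing map of `{0, …, K}` into itself is the identity: `h1` bounds it from below
  -- by induction from 0, and `h2` from above by induction downwards from `K`.
  have h1 : ∀ i ≤ K, i ≤ f i := fun i => by
    induction i with
    | zero => exact fun _ => Nat.zero_le _
    | succ i ih => exact fun hi => (ih (by omega)).trans_lt (hlt i hi)
  have h2 : ∀ d i, i + d = K → f i ≤ i := fun d => by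
    induction d with
    | zero => exact fun i hi => by have := hfK i (by omega); omega
    | succ d ih =>
        intro i hi
        have := ih (i + 1) (by omega)
        have := hlt i (by omega)
        omega
  have hfj : f j = j := le_antisymm (h2 (K - j) j (by omega)) (h1 j hj)
  have hTj := hfT j hj
  have hmin := hf j hj
  rw [hfj] at hTj hmin
  constructor
  · rintro ⟨hn, hn'⟩
    rcases lt_trichotomy n (p j) with h | h | h
    · exact absurd hn (hmin n h)
    · exact h
    · exact absurd hTj (hn' _ h)
  · rintro rfl
    exact ⟨hTj, hmin⟩

/-- The moments that represent the contents `c` of the registers: the distances between successive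
ones are the numbers `c i + 1`. -/
def mark (c : ℕ → ℕ) (j : ℕ) : ℕ := ∑ i ∈ Finset.range j, (c i + 1)

theorem mark_succ (c : ℕ → ℕ) (j : ℕ) : mark c (j + 1) = mark c j + c j + 1 := by
  rw [mark, Finset.sum_range_succ, ← mark, add_assoc]

theorem mark_strictMono (c : ℕ → ℕ) : StrictMono fun j => (mark c j : ℤ) :=
  strictMono_nat_of_lt_succ fun j => by simp only [mark_succ]; omega

/-- Only the marks after the `i`-th move, all by the same amount, so the instructions become shifts
by one moment. -/
theorem mark_update (c : ℕ → ℕ) (i a j : ℕ) :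
    (mark (update c i a) j : ℤ) = mark c j + if j ≤ i then 0 else (a : ℤ) - c i := by
  induction j with
  | zero => simp [mark]
  | succ j ih =>
    rw [mark_succ, mark_succ]
    push_cast
    rw [ih]
    rcases lt_trichotomy j i with h | rfl | h
    · rw [Function.update_of_ne h.ne, if_pos h.le, if_pos (by omega)]
      omega
    · rw [Function.update_self, if_pos le_rfl, if_neg (by omega)]
      omega
    · rw [Function.update_of_ne h.ne', if_neg (by omega), if_neg (by omega)]
      omega

/-! ### Knowledge bases describing counter machines -/

namespace Machine

section Axioms

variable {σ : Type} (β : Fragment) (name : σ → ℕ)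

/-- The `j`-th moment representing the registers, as the first moment of the atom `A_j`. -/
def label (j : ℕ) : Concept β := (Concept.atom j).first

/-- The objects that represent a configuration with state `q`. -/
def inState (q : σ) : Concept β := .atLeast 1 (.sometime (.inv (.flexible (name q))))

/-- The current moment is passed on to an object that represents a configuration with state `q`. -/
def sends (q : σ) : Concept β := .atLeast 1 (.name (.flexible (name q)))

/-- The two outcomes, for `i = 0` and `i = 1`, of a test of a register for zero. -/
def flag (i : ℕ) : Concept β := .atLeast 1 (.name (.rigid i))

/-- In the state `q` and under the condition `C`, the moments `L j` are passed on to the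
state `q'`. -/
def transition (K : ℕ) (q : σ) (C : Concept β) (L : ℕ → Concept β) (q' : σ) :
    List (Concept β × Concept β) :=
  (List.range (K + 1)).map fun j => (.inter (inState β name q) (.inter C (L j)), sends β name q')

/-- The concept inclusions for an instruction in the state `q`. -/
def instrAxioms (K : ℕ) (q : σ) : Instr σ → List (Concept β × Concept β)
  | .halt => [(inState β name q, .bot)]
  | .goto q' => transition β name K q (.neg .bot) (label β) q'
  | .inc i q' => transition β name K q (.neg .bot)
      (fun j => if j ≤ i then label β j else (label β j).after) q'
  | .dec i q₁ q₀ =>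
      -- The moment after mark `i` is mark `i + 1` exactly if register `i` is zero. The comparison
      -- is made at that moment only, but the flag is a rigid role and so guards the transitions at
      -- all marks.
      (.inter (inState β name q) (.inter (label β i).after (label β (i + 1))), flag β 0) ::
      (.inter (inState β name q) (.inter (label β i).after (.neg (label β (i + 1)))), flag β 1) ::
      (transition β name K q (flag β 0) (label β) q₀ ++
        transition β name K q (flag β 1)
          (fun j => if j ≤ i then label β j else (label β j).before) q₁)

/-- The concept inclusions for the state `q`. -/
def stateAxioms (δ : σ → Instr σ) (K : ℕ) (q : σ) : List (Concept β × Concept β) :=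
  -- Functionality of `◇*P`, rather than of `P` at each moment, gathers all outgoing edges in one
  -- object.
  (.atLeast 2 (.sometime (.name (.flexible (name q)))), .bot) ::
  (.atLeast 1 (.inv (.flexible (name q))), Concept.disj ((List.range (K + 1)).map (label β))) ::
  instrAxioms β name K q (δ q)

/-- The concept inclusions for the `j`-th moment. -/
def labelAxioms (j : ℕ) : List (Concept β × Concept β) :=
  [(.atom j, (Concept.atom j).later), (.atom (j + 1), .atom j)]

/-- The knowledge base for a run of the machine `δ`, restricted to the states in `Φ` and the
first `K` registers, from the state `q₀` on the input `m`. -/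
def kb (δ : σ → Instr σ) (Φ : List σ) (K : ℕ) (q₀ : σ) (m : ℕ) : KB β where
  tbox := Φ.flatMap (stateAxioms β name δ K) ++ (List.range (K + 1)).flatMap (labelAxioms β)
  -- Object 0 is the initial configuration; object 1 serves only as the source of its incoming
  -- edges.
  abox := (List.range (K + 1)).map fun j =>
    .role (mark (update (fun _ => 0) 0 m) j) (.flexible (name q₀)) 1 0

end Axioms

section Model

variable {σ : Type} {β : Fragment} {name : σ → ℕ} {δ : σ → Instr σ} {K : ℕ} {Φ : List σ}

theorem forall_transition {P : Concept β × Concept β → Prop} {q q' : σ} {C : Concept β}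
    {L : ℕ → Concept β} : (∀ a ∈ transition β name K q C L q', P a) ↔
      ∀ j ≤ K, P (.inter (inState β name q) (.inter C (L j)), sends β name q') := by
  simp [transition]

/-! #### Models contain the runs of the machine -/

/-- The object `x` represents the state `q` and the contents `c` of the registers. -/
def Represents (I : Interp.{u}) (name : σ → ℕ) (K : ℕ) (x : I.Dom) (q : σ) (c : ℕ → ℕ) : Prop :=
  ∀ j ≤ K, ∃ z, I.flex (name q) (mark c j) z x

variable {I : Interp.{u}} {x : I.Dom} {q q' : σ} {c c' : ℕ → ℕ}

theorem Represents.mem_inState (h : Represents I name K x q c) (n : ℤ) :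
    x ∈ I.concept (inState β name q) n := by
  obtain ⟨z, hz⟩ := h 0 (Nat.zero_le _)
  exact Interp.mem_atLeast_one.2 ⟨z, _, hz⟩

variable (hΦ : ∀ q ∈ Φ, ∀ a ∈ stateAxioms β name δ K q, ∀ n, I.concept a.1 n ⊆ I.concept a.2 n)
  (hK : ∀ j ≤ K, ∀ a ∈ labelAxioms β j, ∀ n, I.concept a.1 n ⊆ I.concept a.2 n)

include hΦ hK in
-- Each of the `K + 1` marks is a moment of an incoming edge, hence the first moment of one of the
-- `K + 1` atoms; `eq_of_first_moments` then matches them index by index.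
theorem Represents.mem_label (h : Represents I name K x q c) (hq : q ∈ Φ) {j : ℕ} (hj : j ≤ K)
    (n : ℤ) : x ∈ I.concept (label β j) n ↔ n = mark c j := by
  have hup : ∀ j ≤ K, ∀ m n, m ≤ n → x ∈ I.concept (.atom j : Concept β) m →
      x ∈ I.concept (.atom j : Concept β) n := fun j hj =>
    Interp.later_iff.1 (hK j hj _ List.mem_cons_self) x
  rw [label, Interp.mem_first (hup j hj)]
  refine eq_of_first_moments (T := fun j n => x ∈ I.concept (.atom j : Concept β) n)
    (mark_strictMono c) (fun i j hij => ?_) (fun i hi => ?_) hj n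
  · induction j, hij using Nat.le_induction with
    | base => exact fun _ _ h => h
    | succ j hij ih =>
      exact fun hj n hn => ih (by omega) n
        (hK j (by omega) _ (List.mem_cons_of_mem _ List.mem_cons_self) n hn)
  · obtain ⟨z, hz⟩ := h i hi
    have hmem := hΦ q hq _ (List.mem_cons_of_mem _ List.mem_cons_self) (mark c i)
      (Interp.mem_atLeast_one.2 ⟨z, hz⟩)
    obtain ⟨C, hC, hx⟩ := Interp.mem_disj.1 hmem
    obtain ⟨j, hj, rfl⟩ := List.mem_map.1 hC
    have hj' : j ≤ K := Nat.lt_succ_iff.1 (List.mem_range.1 hj)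
    exact ⟨j, hj', (Interp.mem_first (hup j hj')).1 hx⟩

include hΦ in
-- An edge leaves `x` at each new mark. All these edges belong to the functional role `◇*P`, so
-- their targets coincide with the target `y` at mark 0.
theorem Represents.exists_of_transition (h : Represents I name K x q c) (hq' : q' ∈ Φ)
    {C : Concept β} {L : ℕ → Concept β}
    (ht : ∀ a ∈ transition β name K q C L q', ∀ n, I.concept a.1 n ⊆ I.concept a.2 n)
    (hC : ∀ n, x ∈ I.concept C n) (hL : ∀ j ≤ K, x ∈ I.concept (L j) (mark c' j)) :
    ∃ y, Represents I name K y q' c' := by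
  rw [forall_transition] at ht
  have hs : ∀ j ≤ K, ∃ y, I.flex (name q') (mark c' j) x y := fun j hj =>
    Interp.mem_atLeast_one.1 (ht j hj _ ⟨h.mem_inState _, hC _, hL j hj⟩)
  obtain ⟨y, hy⟩ := hs 0 (Nat.zero_le _)
  have hfun := Interp.atLeast_two_subset_bot.1 (hΦ q' hq' _ List.mem_cons_self 0)
  refine ⟨y, fun j hj => ?_⟩
  obtain ⟨z, hz⟩ := hs j hj
  rw [hfun x y z ⟨_, hy⟩ ⟨_, hz⟩]
  exact ⟨x, hz⟩

include hΦ hK in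
theorem Represents.step (h : Represents I name K x q c) (hq : q ∈ Φ)
    (hsucc : ∀ q' ∈ (δ q).succs, q' ∈ Φ) (hbound : (δ q).bound ≤ K) :
    δ q ≠ .halt ∧ ∃ y, Represents I name K y ((δ q).exec (q, c)).1 ((δ q).exec (q, c)).2 := by
  have hlabel : ∀ j ≤ K, ∀ n, x ∈ I.concept (label β j) n ↔ n = mark c j := fun j hj =>
    h.mem_label hΦ hK hq hj
  have hax : ∀ a ∈ instrAxioms β name K q (δ q), ∀ n, I.concept a.1 n ⊆ I.concept a.2 n :=
    fun a ha => hΦ q hq a (List.mem_cons_of_mem _ (List.mem_cons_of_mem _ ha))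
  have htop : ∀ n, x ∈ I.concept (.neg .bot : Concept β) n := fun n => by simp [Interp.concept]
  generalize δ q = a at *
  cases a with
  | halt => exact (hax _ List.mem_cons_self 0 (h.mem_inState 0)).elim
  | goto q' =>
    refine ⟨by simp, h.exists_of_transition hΦ (hsucc q' (by simp [Instr.succs])) hax htop ?_⟩
    exact fun j hj => (hlabel j hj _).2 rfl
  | inc i q' =>
    refine ⟨by simp, h.exists_of_transition hΦ (hsucc q' (by simp [Instr.succs])) hax htop ?_⟩
    intro j hj
    rw [Instr.exec, mark_update]
    split_ifs with hji
    · rw [hlabel j hj, add_zero]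
    · rw [Interp.mem_after (hlabel j hj)]
      push_cast
      ring
  | dec i q₁ q₀ =>
    refine ⟨by simp, ?_⟩
    have hi : i + 1 ≤ K := hbound
    simp only [instrAxioms, List.forall_mem_cons, List.forall_mem_append] at hax
    obtain ⟨h0, h1, ht0, ht1⟩ := hax
    have hafter : x ∈ I.concept (label β i).after (mark c i + 1) :=
      (Interp.mem_after (hlabel i (by omega))).2 rfl
    have hnext := hlabel (i + 1) hi (mark c i + 1)
    rw [mark_succ] at hnext
    -- The role is rigid, so membership at one moment is by definition membership at any other.
    have hflag : ∀ k, (∃ n, x ∈ I.concept (flag β k) n) → ∀ n, x ∈ I.concept (flag β k) n := by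
      rintro k ⟨_, hn⟩ n
      exact hn
    by_cases hc : c i = 0
    · have hz := h0 _ ⟨h.mem_inState _, hafter, hnext.2 (by omega)⟩
      rw [Instr.exec, if_pos hc]
      refine h.exists_of_transition hΦ (hsucc q₀ (by simp [Instr.succs])) ht0 (hflag 0 ⟨_, hz⟩) ?_
      exact fun j hj => (hlabel j hj _).2 rfl
    · have hz := h1 _ ⟨h.mem_inState _, hafter, fun hn => hc (by have := hnext.1 hn; omega)⟩
      rw [Instr.exec, if_neg hc]
      refine h.exists_of_transition hΦ (hsucc q₁ (by simp [Instr.succs])) ht1 (hflag 1 ⟨_, hz⟩) ?_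
      intro j hj
      rw [mark_update]
      split_ifs with hji
      · rw [hlabel j hj, add_zero]
      · rw [Interp.mem_before (hlabel j hj)]
        simp only
        omega

theorem ne_halt_of_satisfiable {q₀ : σ} {m : ℕ} (hq₀ : q₀ ∈ Φ)
    (hsucc : ∀ q ∈ Φ, ∀ q' ∈ (δ q).succs, q' ∈ Φ) (hbound : ∀ q ∈ Φ, (δ q).bound ≤ K)
    (hsat : (kb β name δ Φ K q₀ m).Satisfiable) (t : ℕ) :
    δ ((Instr.step δ)^[t] (q₀, update (fun _ => 0) 0 m)).1 ≠ .halt := by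
  obtain ⟨I, ht, ha⟩ := hsat
  simp only [kb, List.forall_mem_append, List.mem_flatMap, List.mem_range, Nat.lt_succ_iff] at ht
  have hΦ : ∀ q ∈ Φ, ∀ a ∈ stateAxioms β name δ K q, ∀ n, I.concept a.1 n ⊆ I.concept a.2 n :=
    fun q hq a ha => ht.1 a ⟨q, hq, ha⟩
  have hK : ∀ j ≤ K, ∀ a ∈ labelAxioms β j, ∀ n, I.concept a.1 n ⊆ I.concept a.2 n :=
    fun j hj a ha => ht.2 a ⟨j, hj, ha⟩
  have hinv : ∀ t, ((Instr.step δ)^[t] (q₀, update (fun _ => 0) 0 m)).1 ∈ Φ ∧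
      ∃ x, Represents I name K x ((Instr.step δ)^[t] (q₀, update (fun _ => 0) 0 m)).1
        ((Instr.step δ)^[t] (q₀, update (fun _ => 0) 0 m)).2 := by
    intro t
    induction t with
    | zero =>
      refine ⟨hq₀, I.obj 0, fun j hj => ⟨I.obj 1, ?_⟩⟩
      exact ha _ (List.mem_map.2 ⟨j, List.mem_range.2 (Nat.lt_succ_iff.2 hj), rfl⟩)
    | succ t ih =>
      obtain ⟨hq, x, hx⟩ := ih
      obtain ⟨hne, hy⟩ := hx.step hΦ hK hq (hsucc _ hq) (hbound _ hq)
      rw [Function.iterate_succ_apply']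
      exact ⟨hsucc _ hq _ (Instr.exec_mem _ _ hne), hy⟩
  obtain ⟨hq, x, hx⟩ := hinv t
  exact (hx.step hΦ hK hq (hsucc _ hq) (hbound _ hq)).1

end Model

/-! #### Infinite runs of the machine yield models -/

section Run

variable {σ : Type} {β : Fragment} {name : σ → ℕ} {δ : σ → Instr σ} {K : ℕ} {Φ : List σ}

/-- The interpretation given by a sequence of configurations: the domain consists of the integers,
and the configuration at time `t` is represented by `t`. -/
def runInterp (name : σ → ℕ) (δ : σ → Instr σ) (K : ℕ) (tr : ℕ → σ × (ℕ → ℕ)) : Interp.{u} where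
  Dom := ULift.{u} ℤ
  -- Thus object 0 is the configuration at time 0 and object 1 is its predecessor `-1`, as the ABox
  -- demands.
  obj i := ⟨-i⟩
  una i j h := by simpa using h
  conc j n := {x | ∃ t : ℕ, x = ⟨t⟩ ∧ mark (tr t).2 j ≤ n}
  flex i n x y := ∃ t : ℕ, y = ⟨t⟩ ∧ x = ⟨t - 1⟩ ∧ name (tr t).1 = i ∧
    ∃ j ≤ K, n = mark (tr t).2 j
  -- Flags only ask whether a successor exists, so the target is left arbitrary.
  rigid k x _ := ∃ t : ℕ, x = ⟨t⟩ ∧ ∃ i q₁ q₀, δ (tr t).1 = .dec i q₁ q₀ ∧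
    if k = 0 then (tr t).2 i = 0 else (tr t).2 i ≠ 0

/-- The object that represents the configuration at time `t`. -/
def conf (name : σ → ℕ) (δ : σ → Instr σ) (K : ℕ) (tr : ℕ → σ × (ℕ → ℕ)) (t : ℕ) :
    (runInterp.{u} name δ K tr).Dom :=
  (⟨t⟩ : ULift.{u} ℤ)

variable {tr : ℕ → σ × (ℕ → ℕ)}

theorem conf_inj {t t' : ℕ} : conf.{u} name δ K tr t = conf name δ K tr t' ↔ t = t' :=
  (ULift.up_inj (α := ℤ)).trans Nat.cast_inj

theorem mem_label_runInterp {t j : ℕ} (n : ℤ) :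
    conf name δ K tr t ∈ (runInterp.{u} name δ K tr).concept (label β j) n ↔
      n = mark (tr t).2 j := by
  have h : ∀ n, conf name δ K tr t ∈
      (runInterp.{u} name δ K tr).concept (.atom j : Concept β) n ↔ mark (tr t).2 j ≤ n :=
    fun n =>
      ⟨fun ⟨_, h, h'⟩ => by rwa [conf_inj.1 h], fun h => ⟨t, rfl, h⟩⟩
  rw [label, Interp.mem_first fun m n hmn hm => (h n).2 (((h m).1 hm).trans hmn)]
  simp only [h]
  constructor
  · rintro ⟨h1, h2⟩
    by_contra hne
    exact h2 (mark (tr t).2 j) (by omega) le_rfl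
  · rintro rfl
    exact ⟨le_rfl, fun k hk => by omega⟩

theorem mem_inState_runInterp {q : σ} {x : (runInterp.{u} name δ K tr).Dom} {n : ℤ}
    (hx : x ∈ (runInterp.{u} name δ K tr).concept (inState β name q) n) :
    ∃ t : ℕ, x = conf name δ K tr t ∧ name (tr t).1 = name q := by
  obtain ⟨_, _, t, rfl, _, h, _⟩ := Interp.mem_atLeast_one.1 hx
  exact ⟨t, rfl, h⟩

theorem mem_sends_runInterp {q : σ} {t j : ℕ} {n : ℤ} (hj : j ≤ K) (hq : (tr (t + 1)).1 = q)
    (hn : n = mark (tr (t + 1)).2 j) :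
    conf name δ K tr t ∈ (runInterp.{u} name δ K tr).concept (sends β name q) n := by
  refine Interp.mem_atLeast_one.2 ⟨conf name δ K tr (t + 1), t + 1, rfl, ?_, by rw [hq], j, hj, hn⟩
  simp [conf]

theorem mem_flag_runInterp {k t : ℕ} {n : ℤ} :
    conf name δ K tr t ∈ (runInterp.{u} name δ K tr).concept (flag β k) n ↔
      ∃ i q₁ q₀, δ (tr t).1 = .dec i q₁ q₀ ∧ if k = 0 then (tr t).2 i = 0 else (tr t).2 i ≠ 0 := by
  rw [flag, Interp.mem_atLeast_one]
  constructor
  · rintro ⟨_, t', h, h'⟩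
    rwa [conf_inj.1 h]
  · exact fun h => ⟨conf name δ K tr t, t, rfl, h⟩

/-- The interpretation sees only the names of states; `hq` recovers the state from its name along
the run. -/
theorem transition_runInterp {q q' : σ} {C : Concept β} {L : ℕ → Concept β}
    (hq : ∀ t, name (tr t).1 = name q → (tr t).1 = q)
    (h : ∀ (t : ℕ) (n : ℤ), (tr t).1 = q →
      conf name δ K tr t ∈ (runInterp.{u} name δ K tr).concept C n →
      (tr (t + 1)).1 = q' ∧ ∀ j ≤ K,
        conf name δ K tr t ∈ (runInterp.{u} name δ K tr).concept (L j) n →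
        n = mark (tr (t + 1)).2 j) :
    ∀ a ∈ transition β name K q C L q', ∀ n,
      (runInterp.{u} name δ K tr).concept a.1 n ⊆ (runInterp.{u} name δ K tr).concept a.2 n := by
  rw [forall_transition]
  rintro j hj n x ⟨hx, hC, hL⟩
  obtain ⟨t, rfl, ht⟩ := mem_inState_runInterp hx
  obtain ⟨h1, h2⟩ := h t n (hq t ht) hC
  exact mem_sends_runInterp hj h1 (h2 j hj hL)

theorem instrAxioms_runInterp {q : σ} (hq : ∀ t, name (tr t).1 = name q → (tr t).1 = q)
    (hhalt : ∀ t, δ (tr t).1 ≠ .halt) (hstep : ∀ t, tr (t + 1) = Instr.step δ (tr t)) :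
    ∀ a ∈ instrAxioms β name K q (δ q), ∀ n,
      (runInterp.{u} name δ K tr).concept a.1 n ⊆ (runInterp.{u} name δ K tr).concept a.2 n := by
  have hstep' : ∀ t a, (tr t).1 = q → δ q = a → tr (t + 1) = a.exec (tr t) := by
    rintro t a rfl rfl
    exact hstep t
  cases ha : δ q with
  | halt =>
    simp only [instrAxioms, List.forall_mem_singleton]
    intro n x hx
    obtain ⟨t, rfl, ht⟩ := mem_inState_runInterp hx
    exact (hhalt t (by rw [hq t ht, ha])).elim
  | goto q' =>
    refine transition_runInterp hq fun t n ht _ => ?_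
    rw [hstep' t _ ht ha]
    exact ⟨rfl, fun j hj hn => (mem_label_runInterp n).1 hn⟩
  | inc i q' =>
    refine transition_runInterp hq fun t n ht _ => ?_
    rw [hstep' t _ ht ha]
    refine ⟨rfl, fun j hj hn => ?_⟩
    rw [Instr.exec, mark_update]
    split_ifs at hn ⊢ with hji
    · rw [(mem_label_runInterp n).1 hn, add_zero]
    · rw [(Interp.mem_after mem_label_runInterp).1 hn]
      push_cast
      ring
  | dec i q₁ q₀ =>
    have hmark : ∀ t, mark (tr t).2 (i + 1) = mark (tr t).2 i + (tr t).2 i + 1 := fun t =>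
      mark_succ _ _
    have hflag : ∀ {k t : ℕ} {n : ℤ}, (tr t).1 = q →
        (conf name δ K tr t ∈ (runInterp.{u} name δ K tr).concept (flag β k) n ↔
          if k = 0 then (tr t).2 i = 0 else (tr t).2 i ≠ 0) := by
      intro k t n ht
      rw [mem_flag_runInterp, ht, ha]
      constructor
      · rintro ⟨_, _, _, h, h'⟩
        cases h
        exact h'
      · exact fun h => ⟨i, q₁, q₀, rfl, h⟩
    simp only [instrAxioms, List.forall_mem_cons, List.forall_mem_append]
    refine ⟨?_, ?_, ?_, ?_⟩
    · rintro n x ⟨hx, h1, h2⟩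
      obtain ⟨t, rfl, ht⟩ := mem_inState_runInterp hx
      have h1 := (Interp.mem_after mem_label_runInterp).1 h1
      have h2 := (mem_label_runInterp n).1 h2
      have := hmark t
      exact (hflag (hq t ht)).2 (by rw [if_pos rfl]; omega)
    · rintro n x ⟨hx, h1, h2⟩
      obtain ⟨t, rfl, ht⟩ := mem_inState_runInterp hx
      have h1 := (Interp.mem_after mem_label_runInterp).1 h1
      have h2 : ¬n = _ := fun h => h2 ((mem_label_runInterp n).2 h)
      have := hmark t
      exact (hflag (hq t ht)).2 (by rw [if_neg one_ne_zero]; omega)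
    · refine transition_runInterp hq fun t n ht hC => ?_
      have hz := (hflag ht).1 hC
      rw [if_pos rfl] at hz
      rw [hstep' t _ ht ha, Instr.exec, if_pos hz]
      exact ⟨rfl, fun j hj hn => (mem_label_runInterp n).1 hn⟩
    · refine transition_runInterp hq fun t n ht hC => ?_
      have hz := (hflag ht).1 hC
      rw [if_neg one_ne_zero] at hz
      rw [hstep' t _ ht ha, Instr.exec, if_neg hz]
      refine ⟨rfl, fun j hj hn => ?_⟩
      rw [mark_update]
      split_ifs at hn ⊢ with hji
      · rw [(mem_label_runInterp n).1 hn, add_zero]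
      · rw [(Interp.mem_before mem_label_runInterp).1 hn]
        omega

theorem satisfiable_of_ne_halt {q₀ : σ} {m : ℕ} (hname : Set.InjOn name {q | q ∈ Φ})
    (hq₀ : q₀ ∈ Φ) (hsucc : ∀ q ∈ Φ, ∀ q' ∈ (δ q).succs, q' ∈ Φ)
    (hhalt : ∀ t, δ ((Instr.step δ)^[t] (q₀, update (fun _ => 0) 0 m)).1 ≠ .halt) :
    KB.Satisfiable.{u} (kb β name δ Φ K q₀ m) := by
  set tr : ℕ → σ × (ℕ → ℕ) := fun t => (Instr.step δ)^[t] (q₀, update (fun _ => 0) 0 m) with htr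
  have hstep : ∀ t, tr (t + 1) = Instr.step δ (tr t) := fun t => Function.iterate_succ_apply' ..
  have hΦ : ∀ t, (tr t).1 ∈ Φ := by
    intro t
    induction t with
    | zero => exact hq₀
    | succ t ih =>
      rw [hstep]
      exact hsucc _ ih _ (Instr.exec_mem _ _ (hhalt t))
  refine ⟨runInterp name δ K tr, ?_, ?_⟩
  · simp only [kb, List.forall_mem_append, List.forall_mem_flatMap, stateAxioms, labelAxioms,
      List.forall_mem_cons]
    refine ⟨fun q hq => ⟨fun n => ?_, fun n => ?_, ?_⟩, fun j hj => ⟨?_, fun n => ?_, by simp⟩⟩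
    -- In every flexible role and at every moment, the only possible successor of an integer `x` is
    -- `x + 1`.
    · rw [Interp.atLeast_two_subset_bot]
      rintro x y z ⟨_, t, rfl, hx, _⟩ ⟨_, t', rfl, hx', _⟩
      rw [hx, ULift.up_inj] at hx'
      exact conf_inj.2 (by omega)
    · intro x hx
      obtain ⟨_, t, rfl, _, _, j, hj, hn⟩ := Interp.mem_atLeast_one.1 hx
      exact Interp.mem_disj.2 ⟨label β j, List.mem_map_of_mem (List.mem_range.2 (by omega)),
        (mem_label_runInterp n).2 hn⟩
    · exact instrAxioms_runInterp (fun t ht => hname (hΦ t) hq ht) hhalt hstep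
    · rw [Interp.later_iff]
      rintro x m n hmn ⟨t, rfl, h⟩
      exact ⟨t, rfl, h.trans hmn⟩
    · rintro x ⟨t, rfl, h⟩
      exact ⟨t, rfl, (mark_strictMono _ j.lt_succ_self).le.trans h⟩
  · simp only [kb, List.forall_mem_map, List.mem_range]
    intro j hj
    exact ⟨0, by simp [runInterp], by simp [runInterp], rfl, j, by omega, rfl⟩

end Run

/-! ### Computability of the reduction -/

/-- The TBox is constant, and the ABox is a list of fixed length in which only the moments `mark …
j` depend on `m`. -/
theorem primrec_kb {σ : Type} (β : Fragment) (name : σ → ℕ) (δ : σ → Instr σ) (Φ : List σ) (K : ℕ)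
    (q₀ : σ) : Primrec (kb β name δ Φ K q₀) := by
  have hmark : ∀ j, Primrec fun m => mark (update (fun _ => 0) 0 m) j := by
    intro j
    induction j with
    | zero => exact Primrec.const 0
    | succ j ih =>
      simp only [mark_succ]
      refine Primrec.succ.comp (Primrec.nat_add.comp ih ?_)
      rcases eq_or_ne j 0 with rfl | hj
      · simp only [Function.update_self]
        exact Primrec.id
      · simpa [hj] using Primrec.const 0
  have hcast : Primrec fun n : ℕ => (n : ℤ) := by
    rw [← Primrec.encode_iff]
    -- The code of a non-negative integer `n` is `2 * n`.
    exact (Primrec.nat_mul.comp (Primrec.const 2) Primrec.id).of_eq fun n => rfl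
  have hassertion : ∀ j, Primrec fun m => Assertion.role (mark (update (fun _ => 0) 0 m) j)
      (.flexible (name q₀)) 1 0 := by
    intro j
    have h : Primrec fun m => Assertion.equivSum.symm (Sum.inr (Sum.inl
        ((mark (update (fun _ => 0) 0 m) j : ℤ), RoleName.flexible (name q₀), 1, 0))) :=
      (Primrec.of_equiv_symm (e := Assertion.equivSum)).comp (Primrec.sumInr.comp
        (Primrec.sumInl.comp ((hcast.comp (hmark j)).pair (Primrec.const _))))
    exact h
  have habox : ∀ l : List ℕ, Primrec fun m => l.map fun j =>
      Assertion.role (mark (update (fun _ => 0) 0 m) j) (.flexible (name q₀)) 1 0 := by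
    intro l
    induction l with
    | nil => exact Primrec.const []
    | cons j l ih => exact Primrec.list_cons.comp (hassertion j) ih
  have h : Primrec fun m => (KB.equivProd β).symm ((kb β name δ Φ K q₀ 0).tbox,
      (List.range (K + 1)).map fun j =>
        Assertion.role (mark (update (fun _ => 0) 0 m) j) (.flexible (name q₀)) 1 0) :=
    (Primrec.of_equiv_symm (e := KB.equivProd β)).comp ((Primrec.const _).pair (habox _))
  exact h

end Machine

theorem not_computablePred_satisfiable (β : Fragment) :
    ¬ ComputablePred fun K : KB β => KB.Satisfiable.{u} K := by
  classical
  obtain ⟨σ, δ, Φ, q₀, K, hq₀, hsucc, hbound, hM⟩ := exists_counterMachine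
  -- States are named by their positions in the list `Φ`, which are distinct for distinct members.
  have hname : Set.InjOn (fun q => Φ.idxOf q) {q | q ∈ Φ} := fun q hq q' _ h =>
    (List.idxOf_inj hq).1 h
  intro h
  refine hM ?_
  have h' : ComputablePred fun m =>
      KB.Satisfiable.{u} (Machine.kb β (fun q => Φ.idxOf q) δ Φ K q₀ m) :=
    ComputablePred.computable_of_manyOneReducible
      ⟨_, (Machine.primrec_kb β _ δ Φ K q₀).to_comp, fun _ => Iff.rfl⟩ h
  refine h'.not.of_eq fun m => ⟨fun hsat => ?_, ?_⟩
  · by_contra hne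
    exact hsat (Machine.satisfiable_of_ne_halt hname hq₀ hsucc (not_exists.1 hne))
  · rintro ⟨t, ht⟩ hsat
    exact Machine.ne_halt_of_satisfiable hq₀ hsucc hbound hsat t ht

end TDL

/-- Satisfiability of knowledge bases is undecidable, both with next and previous time and with
always in the future and in the past as the temporal operators on concepts. -/
theorem mainTheorem1 :
    (¬ ComputablePred fun K : TDL.KB TDL.Fragment.X => TDL.KB.Satisfiable.{u} K) ∧
      ¬ ComputablePred fun K : TDL.KB TDL.Fragment.FP => TDL.KB.Satisfiable.{u} K :=
  ⟨TDL.not_computablePred_satisfiable .X, TDL.not_computablePred_satisfiable .FP⟩
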